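/- Let $r\in(0,1)$. Let $(X,d)$ be a compact metric space and let $G$ be a finite directed graph (parallel edges and loops allowed) with vertices $1,\dots,p$, with $\mathcal E_{i,j}$ the set of edges from $i$ to $j$, such that to each edge $e$ there is attached a map $S_e:X\to X$ with $d(S_ex,S_ey)=r\,d(x,y)$ for all $x,y\in X$. Non-empty compact sets $K_1,\dots,K_p\subset X$ with $$K_i=\bigcup_{j}\bigcup_{e\in\mathcal E_{i,j}}S_e(K_j)\qquad(1\le i\le p)$$ are called dust-like graph-directed sets with ratio $r$ if for every $i$ the sets $S_e(K_j)$ on the right-hand side (over all $j$ and all $e\in\mathcal E_{i,j}$) are pairwise disjoint. They have integer characteristic $m$, where $m\ge 2$ is an integer, if the matrix $A=(\#\mathcal E_{i,j})_{i,j}$ satisfies $Av=mv$ for some vector $v$ with positive entries. Let $\mathfrak A^r_m$ be the class of all sets $K=K_1$ belonging to some dust-like graph-directed sets $\{K_i\}_i$ with ratio $r$ and integer characteristic $m$ (in some compact metric space), and let $\mathfrak A^r=\bigcup_{m\ge2}\mathfrak A^r_m$. Two metric spaces $B,B'$ are bilipschitz equivalent if there are a bijection $f:B\to B'$ and a constant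 $C>0$ with $C^{-1}d(x,y)\le d'(f(x),f(y))\le C\,d(x,y)$ for all $x,y\in B$. Theorem 2. (a) For each $r\in(0,1)$, the fractals in $\mathfrak A^r$ are determined up to bilipschitz equivalence by their Hausdorff dimension, and equally by their characteristic: for $K,K'\in\mathfrak A^r$, $K$ and $K'$ are bilipschitz equivalent if and only if $\dim_HK=\dim_HK'$; and if $K\in\mathfrak A^r_m$ and $K'\in\mathfrak A^r_{m'}$, then $K$ and $K'$ are bilipschitz equivalent if and only if $m=m'$. (b) Let $r_1,r_2\in(0,1)$, $m_1,m_2\geq 2$, $K\in\mathfrak A^{r_1}_{m_1}$ and $K'\in\mathfrak A^{r_2}_{m_2}$. Then $K$ and $K'$ are bilipschitz equivalent if and only if $r_1^{k_1}=r_2^{k_2}$ and $m_1^{k_1}=m_2^{k_2}$ for some integers $k_1,k_2\ge1$. -/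

import Mathlib

/-- Two metric spaces are bilipschitz equivalent: there is a bijection `f` and a constant `C > 0`
with `C⁻¹ d(x, y) ≤ d(f x, f y) ≤ C d(x, y)` for all `x, y`. -/
def BilipschitzEquivalent (B B' : Type*) [MetricSpace B] [MetricSpace B'] : Prop :=
  ∃ (f : B ≃ B') (C : ℝ), 0 < C ∧
    ∀ x y : B, C⁻¹ * dist x y ≤ dist (f x) (f y) ∧ dist (f x) (f y) ≤ C * dist x y

/-- A finite directed multigraph on the vertices `Fin p`, with the finite set `E i j` of edges from
`i` to `j`, together with a similitude `S e : X → X` of ratio `r` for every edge `e`. -/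
structure GraphSystem (X : Type*) [MetricSpace X] (r : ℝ) where
  /-- the number of vertices -/
  p : ℕ
  /-- the edges from `i` to `j` -/
  E : Fin p → Fin p → Type
  /-- there are finitely many edges -/
  fintypeE : ∀ i j, Fintype (E i j)
  /-- the similitude attached to an edge -/
  S : ∀ {i j : Fin p}, E i j → X → X
  /-- every `S e` is a similitude of ratio `r` -/
  dist_S : ∀ {i j : Fin p} (e : E i j) (x y : X), dist (S e x) (S e y) = r * dist x y

namespace GraphSystem

variable {X : Type*} [MetricSpace X] {r : ℝ}

/-- The adjacency matrix `a i j = #(E i j)`, with real entries. -/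
def adjMatrix (G : GraphSystem X r) : Matrix (Fin G.p) (Fin G.p) ℝ :=
  fun i j => (@Fintype.card (G.E i j) (G.fintypeE i j) : ℝ)

/-- `K` is the family of graph-directed sets of `G`: nonempty compact sets with
`K i = ⋃ j, ⋃ e ∈ E i j, S e (K j)` for every vertex `i`. -/
structure IsGraphDirectedFamily (G : GraphSystem X r) (K : Fin G.p → Set X) : Prop where
  isCompact : ∀ i, IsCompact (K i)
  nonempty : ∀ i, (K i).Nonempty
  eq_iUnion : ∀ i, K i = ⋃ j, ⋃ e : G.E i j, G.S e '' K j

/-- The family `K` is dust-like: for every vertex `i`, the sets `S e (K j)`, where `e` runs over all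
the edges from `i` to any vertex `j`, are pairwise disjoint. -/
def IsDustLike (G : GraphSystem X r) (K : Fin G.p → Set X) : Prop :=
  ∀ i, Pairwise fun e e' : Σ j, G.E i j =>
    Disjoint (G.S e.2 '' K e.1) (G.S e'.2 '' K e'.1)

/-- Integer characteristic `m ≥ 2`: the adjacency matrix `A` has a positive vector `v` with
`A v = m v`. -/
def HasIntegerCharacteristic (G : GraphSystem X r) (m : ℕ) : Prop :=
  2 ≤ m ∧ ∃ v : Fin G.p → ℝ, (∀ i, 0 < v i) ∧ G.adjMatrix.mulVec v = (m : ℝ) • v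

end GraphSystem

/-- The members, among the subsets of the metric space `X`, of the class of fractals with ratio `r`
and integer characteristic `m`: the sets that occur in a family of dust-like graph-directed sets
with ratio `r` and integer characteristic `m`. (The vertices may be renumbered, so it does not
matter at which vertex the set occurs.) -/
def FractalClassOf (X : Type*) [MetricSpace X] (r : ℝ) (m : ℕ) : Set (Set X) :=
  {K₀ | ∃ (G : GraphSystem X r) (K : Fin G.p → Set X) (i : Fin G.p),
    G.IsGraphDirectedFamily K ∧ G.IsDustLike K ∧ G.HasIntegerCharacteristic m ∧ K₀ = K i}

/-- The union over `m ≥ 2` of the classes with ratio `r` and integer characteristic `m`. -/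
def FractalClass (X : Type*) [MetricSpace X] (r : ℝ) : Set (Set X) :=
  ⋃ m : ℕ, FractalClassOf X r m

/-! Everything is compared with one model: a set with ratio r and characteristic m is bilipschitz
equivalent to the full shift on m letters, with distance r^n for a common prefix of length n
(`bilipschitzEquivalent_symbolicSpace`). The shift has dimension log m / -log r, which settles (a).
Grouping letters into blocks of length k replaces (m, r) by (m^k, r^k), which gives the "if"
direction of (b).

For the comparison, the positive eigenvector is first made integral (`exists_nat_eigenvector`). A
copy of K_i may stand for any number h of sibling cylinders with a_i ≤ h ≤ b_i. A long iterate of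
the system splits it into pieces, indexed by paths. These are distributed to h bins, one for each
cylinder, and the m^N subcylinders of a bin are shared among its pieces so that each piece again
receives an admissible number. There are only finitely many states (i, h), and reading the itinerary
of a point through them produces its code with bounded distortion. The distribution exists by
`Matrix.exists_bin_packing`: in a final class of the graph the weights are exactly conserved, so at
the ends of the range an exact partition is needed, and Bézout coefficients supply it; in all other
cases there is slack that grows with the length of the paths, and a nearly even distribution
suffices.

The "only if" direction of (b) is a rigidity argument
(`SymbolicSpace.exists_pow_eq_of_bilipschitzEquivalent`). Pull the Hausdorff measure back along the
map. Its density on a cylinder is an integer multiple of a scale bounded below, and it is the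
average of the densities on the children. Near its supremum the density is therefore constant along
a whole chain of nested cylinders. The integers on the chain are bounded, so one of them repeats,
and the two levels give a power of m₁ equal to a power of m₂. -/

/-! ### Bilipschitz equivalence. -/

theorem BilipschitzEquivalent.of_surjective {B B' : Type*} [MetricSpace B] [MetricSpace B']
    (f : B → B') (hf : Function.Surjective f) {a b : ℝ} (ha : 0 < a)
    (h₁ : ∀ x y, dist x y ≤ a * dist (f x) (f y)) (h₂ : ∀ x y, dist (f x) (f y) ≤ b * dist x y) :
    BilipschitzEquivalent B B' := by
  have hinj : Function.Injective f := fun x y hxy => by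
    have := h₁ x y
    rw [hxy, dist_self, mul_zero] at this
    exact dist_le_zero.1 this
  refine ⟨Equiv.ofBijective f ⟨hinj, hf⟩, max a b, lt_max_of_lt_left ha, fun x y => ⟨?_, ?_⟩⟩
  · rw [inv_mul_le_iff₀ (lt_max_of_lt_left ha)]
    exact (h₁ x y).trans (mul_le_mul_of_nonneg_right (le_max_left _ _) dist_nonneg)
  · exact (h₂ x y).trans (mul_le_mul_of_nonneg_right (le_max_right _ _) dist_nonneg)

theorem BilipschitzEquivalent.symm {B B' : Type*} [MetricSpace B] [MetricSpace B']
    (h : BilipschitzEquivalent B B') : BilipschitzEquivalent B' B := by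
  obtain ⟨f, C, hC, h⟩ := h
  refine .of_surjective f.symm f.symm.surjective hC (b := C) (fun x y => ?_) fun x y => ?_
  · simpa using (h (f.symm x) (f.symm y)).2
  · have := (h (f.symm x) (f.symm y)).1
    rw [inv_mul_le_iff₀ hC] at this
    simpa using this

theorem BilipschitzEquivalent.trans {B B' B'' : Type*} [MetricSpace B] [MetricSpace B']
    [MetricSpace B''] (h : BilipschitzEquivalent B B') (h' : BilipschitzEquivalent B' B'') :
    BilipschitzEquivalent B B'' := by
  obtain ⟨f, C, hC, h⟩ := h
  obtain ⟨g, C', hC', h'⟩ := h'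
  refine .of_surjective (g ∘ f) (g.surjective.comp f.surjective) (mul_pos hC hC') (b := C' * C)
    (fun x y => ?_) fun x y => ?_
  · have h1 := (h x y).1
    have h2 := (h' (f x) (f y)).1
    rw [inv_mul_le_iff₀ hC] at h1
    rw [inv_mul_le_iff₀ hC'] at h2
    calc dist x y ≤ C * dist (f x) (f y) := h1
      _ ≤ C * (C' * dist (g (f x)) (g (f y))) := by gcongr
      _ = _ := by simp [mul_assoc]
  · calc dist (g (f x)) (g (f y)) ≤ C' * dist (f x) (f y) := (h' _ _).2
      _ ≤ C' * (C * dist x y) := by gcongr; exact (h x y).2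
      _ = _ := by ring

/-! ### The symbolic spaces and criteria for equivalence to them. -/

/-- The space of infinite sequences over an alphabet with `m` letters, with the metric
`r ^ n`, where `n` is the length of the longest common prefix. -/
def SymbolicSpace (m : ℕ) (_r : ℝ) : Type := ℕ → Fin m

namespace SymbolicSpace

variable {m : ℕ} {r : ℝ}

open Classical in
noncomputable instance instDist : Dist (SymbolicSpace m r) :=
  ⟨fun x y => if x = y then 0 else r ^ PiNat.firstDiff (E := fun _ => Fin m) x y⟩

theorem dist_eq_of_ne {x y : SymbolicSpace m r} (h : x ≠ y) :
    dist x y = r ^ PiNat.firstDiff (E := fun _ => Fin m) x y := if_neg h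

theorem dist_self_eq (x : SymbolicSpace m r) : dist x x = 0 := if_pos rfl

theorem exists_dist_eq_pow {x y : SymbolicSpace m r} (h : x ≠ y) :
    ∃ l : ℕ, dist x y = r ^ l ∧ x l ≠ y l :=
  ⟨_, dist_eq_of_ne h, PiNat.apply_firstDiff_ne (E := fun _ => Fin m) h⟩

variable [hr : Fact (r ∈ Set.Ioo (0 : ℝ) 1)]

theorem dist_le_pow_iff {x y : SymbolicSpace m r} {n : ℕ} :
    dist x y ≤ r ^ n ↔ ∀ i < n, x i = y i := by
  by_cases h : x = y
  · subst h
    simp only [dist_self_eq, implies_true, iff_true]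
    exact pow_nonneg hr.out.1.le n
  · rw [dist_eq_of_ne h, pow_le_pow_iff_right_of_lt_one₀ hr.out.1 hr.out.2]
    rw [← PiNat.mem_cylinder_iff_le_firstDiff (E := fun _ => Fin m) h]
    rfl

theorem dist_triangle_max (x y z : SymbolicSpace m r) :
    dist x z ≤ max (dist x y) (dist y z) := by
  have h0 : ∀ x y : SymbolicSpace m r, 0 ≤ dist x y := fun x y => by
    by_cases h : x = y
    · rw [h, dist_self_eq]
    · rw [dist_eq_of_ne h]; exact pow_nonneg hr.out.1.le _
  by_cases hxy : x = y
  · subst hxy; exact le_max_right _ _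
  by_cases hyz : y = z
  · subst hyz; exact le_max_left _ _
  rw [dist_eq_of_ne hxy, dist_eq_of_ne hyz, ← (pow_right_anti₀ hr.out.1.le hr.out.2.le).map_min,
    dist_le_pow_iff]
  intro i hi
  rw [lt_min_iff] at hi
  exact (PiNat.apply_eq_of_lt_firstDiff (E := fun _ => Fin m) hi.1).trans
    (PiNat.apply_eq_of_lt_firstDiff (E := fun _ => Fin m) hi.2)

noncomputable instance instMetricSpace : MetricSpace (SymbolicSpace m r) where
  dist_self := dist_self_eq
  dist_comm x y := by
    by_cases h : x = y
    · rw [h]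
    · rw [dist_eq_of_ne h, dist_eq_of_ne (Ne.symm h)]
      exact congrArg (r ^ ·) (PiNat.firstDiff_comm (E := fun _ => Fin m) x y)
  dist_triangle x y z := by
    refine (dist_triangle_max x y z).trans (max_le_add_of_nonneg ?_ ?_) <;>
    · rw [instDist]
      dsimp only
      split_ifs
      exacts [le_rfl, pow_nonneg hr.out.1.le _]
  eq_of_dist_eq_zero {x y} h := by
    by_contra hne
    rw [dist_eq_of_ne hne] at h
    exact (pow_pos hr.out.1 _).ne' h

/-- Comparing metrics only at the depths `t + N * n` is enough: any other depth is within `t + N` of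
one of these, which costs a constant factor. -/
theorem bilipschitzEquivalent_of_agree {B : Type*} [MetricSpace B] (f : B → SymbolicSpace m r)
    (hf : Function.Surjective f) (t : ℕ) {N : ℕ} (hN : 0 < N) {c D : ℝ} (hc : 0 < c) (hD : 0 < D)
    (hbdd : ∀ x y : B, dist x y ≤ D)
    (hle : ∀ (x y : B) (n : ℕ), (∀ i < t + N * n, f x i = f y i) → dist x y ≤ D * r ^ (N * n))
    (hlt : ∀ (x y : B) (n : ℕ), dist x y < c * r ^ (N * n) → ∀ i < t + N * n, f x i = f y i) :
    BilipschitzEquivalent B (SymbolicSpace m r) := by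
  have hr0 := hr.out.1
  have hr1 := hr.out.2
  refine .of_surjective f hf (a := D / r ^ (t + N)) (b := (c * r ^ N)⁻¹) (by positivity)
    (fun x y => ?_) fun x y => ?_
  · by_cases hxy : f x = f y
    · rw [hxy, dist_self, mul_zero]
      have : Filter.Tendsto (fun n : ℕ => D * r ^ (N * n)) Filter.atTop (nhds (D * 0)) := by
        refine Filter.Tendsto.const_mul _ ?_
        simp_rw [pow_mul]
        exact tendsto_pow_atTop_nhds_zero_of_lt_one (by positivity)
          (pow_lt_one₀ hr0.le hr1 hN.ne')
      rw [mul_zero] at this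
      exact ge_of_tendsto' this fun n => hle x y n fun i _ => by rw [hxy]
    · have hd := dist_eq_of_ne hxy
      set l := PiNat.firstDiff (E := fun _ => Fin m) (f x) (f y) with hl
      rw [hd, div_mul_eq_mul_div, le_div_iff₀ (by positivity)]
      by_cases ht : l < t
      · exact mul_le_mul (hbdd x y) (pow_le_pow_of_le_one hr0.le hr1.le (by omega))
          (by positivity) hD.le
      · have h1 : t + N * ((l - t) / N) ≤ l := by
          have := Nat.mul_div_le (l - t) N
          omega
        have h2 : l ≤ N * ((l - t) / N) + (t + N) := by
          have := Nat.lt_mul_div_succ (l - t) hN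
          rw [mul_add, mul_one] at this
          omega
        have h3 := hle x y ((l - t) / N) fun i hi =>
          PiNat.apply_eq_of_lt_firstDiff (E := fun _ => Fin m) (hi.trans_le h1)
        calc dist x y * r ^ (t + N) ≤ D * r ^ (N * ((l - t) / N)) * r ^ (t + N) := by gcongr
          _ = D * r ^ (N * ((l - t) / N) + (t + N)) := by ring
          _ ≤ D * r ^ l := by
              gcongr ?_ * ?_
              exact pow_le_pow_of_le_one hr0.le hr1.le h2
  · by_cases hxy : f x = f y
    · rw [hxy, dist_self]; positivity
    obtain ⟨l, hd, hl⟩ := exists_dist_eq_pow hxy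
    rw [hd, inv_mul_eq_div, le_div_iff₀ (by positivity)]
    by_contra! hlt'
    refine hl (hlt x y (l / N + 1) ?_ l ?_)
    · have : N * (l / N + 1) ≤ l + N := by
        have := Nat.mul_div_le l N
        rw [mul_add]; omega
      calc dist x y < r ^ l * (c * r ^ N) := by linarith
        _ = c * r ^ (l + N) := by ring
        _ ≤ c * r ^ (N * (l / N + 1)) := by
            gcongr ?_ * ?_
            exact pow_le_pow_of_le_one hr0.le hr1.le this
    · have := Nat.lt_mul_div_succ l hN
      omega

end SymbolicSpace

/-! ### Expanding block codes into base `m` digits. -/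

theorem Nat.eq_of_forall_div_pow_mod_eq {m n a b : ℕ} (ha : a < m ^ n) (hb : b < m ^ n)
    (h : ∀ i < n, a / m ^ i % m = b / m ^ i % m) : a = b := by
  have : (⟨a, ha⟩ : Fin (m ^ n)) = ⟨b, hb⟩ := finFunctionFinEquiv.symm.injective <| by
    ext i
    exact h i i.2
  simpa using this

theorem Nat.exists_forall_div_pow_mod_eq {m n : ℕ} (d : ℕ → Fin m) :
    ∃ a < m ^ n, ∀ i < n, a / m ^ i % m = d i := by
  refine ⟨finFunctionFinEquiv fun i : Fin n => d i, Fin.is_lt _, fun i hi => ?_⟩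
  have := congrFun (finFunctionFinEquiv.symm_apply_apply fun i : Fin n => d i) ⟨i, hi⟩
  exact congrArg Fin.val this

/-- Concatenate the base `m` expansions of the terms of a sequence: `t` digits of `a 0`, and `N`
digits of each of the following terms. -/
def expandDigits (m t N : ℕ) [NeZero m] (a : ℕ → ℕ) (i : ℕ) : Fin m :=
  if i < t then Fin.ofNat m (a 0 / m ^ i)
  else Fin.ofNat m (a ((i - t) / N + 1) / m ^ ((i - t) % N))

theorem expandDigits_eq_iff {m t N : ℕ} [NeZero m] (hN : 0 < N) {a b : ℕ → ℕ}
    (ha : a 0 < m ^ t) (hb : b 0 < m ^ t) (ha' : ∀ n, a (n + 1) < m ^ N)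
    (hb' : ∀ n, b (n + 1) < m ^ N) (n : ℕ) :
    (∀ i < t + N * n, expandDigits m t N a i = expandDigits m t N b i) ↔
      ∀ k ≤ n, a k = b k := by
  constructor
  · intro h k hk
    rcases k with _ | k
    · refine Nat.eq_of_forall_div_pow_mod_eq ha hb fun i hi => ?_
      have := h i (by omega)
      simpa [expandDigits, hi, Fin.ext_iff] using this
    · refine Nat.eq_of_forall_div_pow_mod_eq (ha' k) (hb' k) fun i hi => ?_
      have h1 : N * k + N ≤ N * n := by
        rw [← Nat.mul_succ]; exact Nat.mul_le_mul_left _ hk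
      have := h (t + (N * k + i)) (by omega)
      simpa [expandDigits, Nat.mul_add_div hN, Nat.div_eq_of_lt hi, Nat.mod_eq_of_lt hi,
        Fin.ext_iff] using this
  · intro h i hi
    by_cases hit : i < t
    · simp [expandDigits, hit, h 0 (Nat.zero_le _)]
    · have : (i - t) / N < n := by
        rw [Nat.div_lt_iff_lt_mul hN, mul_comm]
        omega
      simp [expandDigits, hit, h _ this]

theorem exists_expandDigits_eq {m t N : ℕ} [NeZero m] (hN : 0 < N) (d : ℕ → Fin m) :
    ∃ a : ℕ → ℕ, a 0 < m ^ t ∧ (∀ n, a (n + 1) < m ^ N) ∧ expandDigits m t N a = d := by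
  obtain ⟨a₀, ha₀, h₀⟩ := Nat.exists_forall_div_pow_mod_eq (n := t) d
  choose a ha h using fun k : ℕ =>
    Nat.exists_forall_div_pow_mod_eq (n := N) fun i => d (t + (N * k + i))
  refine ⟨fun n => Nat.casesOn n a₀ a, ha₀, ha, ?_⟩
  ext i
  by_cases hit : i < t
  · simp [expandDigits, hit, h₀ i hit]
  · have h1 := h ((i - t) / N) ((i - t) % N) (Nat.mod_lt _ hN)
    rw [Nat.div_add_mod, Nat.add_sub_cancel' (not_lt.1 hit)] at h1
    simp [expandDigits, hit, h1]

namespace SymbolicSpace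

variable {m : ℕ} {r : ℝ} [hr : Fact (r ∈ Set.Ioo (0 : ℝ) 1)]

/-- A metric space with a block coding by integer sequences that reflects the metric is
bilipschitz equivalent to the symbolic space. -/
theorem bilipschitzEquivalent_of_code (hm : 0 < m) {B : Type*} [MetricSpace B] (F : B → ℕ → ℕ)
    (t : ℕ) {N : ℕ} (hN : 0 < N) {c D : ℝ} (hc : 0 < c) (hD : 0 < D)
    (h0 : ∀ x, F x 0 < m ^ t) (hs : ∀ x n, F x (n + 1) < m ^ N)
    (hbdd : ∀ x y : B, dist x y ≤ D)
    (hle : ∀ (x y : B) (n : ℕ), (∀ k ≤ n, F x k = F y k) → dist x y ≤ D * (r ^ N) ^ n)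
    (hlt : ∀ (x y : B) (n : ℕ), dist x y < c * (r ^ N) ^ n → ∀ k ≤ n, F x k = F y k)
    (hsurj : ∀ a : ℕ → ℕ, a 0 < m ^ t → (∀ n, a (n + 1) < m ^ N) → ∃ x, F x = a) :
    BilipschitzEquivalent B (SymbolicSpace m r) := by
  have : NeZero m := ⟨hm.ne'⟩
  refine bilipschitzEquivalent_of_agree (fun x => expandDigits m t N (F x)) ?_ t hN hc hD hbdd ?_ ?_
  · intro d
    obtain ⟨a, ha, ha', h⟩ := exists_expandDigits_eq (t := t) hN d
    obtain ⟨x, rfl⟩ := hsurj a ha ha'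
    exact ⟨x, h⟩
  · intro x y n h
    rw [pow_mul]
    exact hle x y n ((expandDigits_eq_iff hN (h0 x) (h0 y) (hs x) (hs y) n).1 h)
  · intro x y n h
    rw [pow_mul] at h
    exact (expandDigits_eq_iff hN (h0 x) (h0 y) (hs x) (hs y) n).2 (hlt x y n h)

/-- A letter of the big alphabet is a block of `k` letters of the small one. -/
theorem bilipschitzEquivalent_pow (hm : 0 < m) {k q : ℕ} {ρ : ℝ}
    [hr' : Fact (ρ ∈ Set.Ioo (0 : ℝ) 1)] (hk : 0 < k) (hq : q = m ^ k) (hρ : ρ = r ^ k) :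
    BilipschitzEquivalent (SymbolicSpace q ρ) (SymbolicSpace m r) := by
  subst hq hρ
  refine bilipschitzEquivalent_of_code hm (fun x n => (x n : ℕ)) k hk one_pos one_pos
    (fun x => (x 0).2) (fun x n => (x (n + 1)).2) (fun x y => ?_) (fun x y n h => ?_)
    (fun x y n h => ?_) fun a ha ha' => ?_
  · simpa using (dist_le_pow_iff (x := x) (y := y) (n := 0)).2 (by simp)
  · rw [one_mul]
    exact dist_le_pow_iff.2 fun i hi => Fin.ext (h i hi.le)
  · intro i hi
    rw [one_mul] at h
    by_cases hxy : x = y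
    · rw [hxy]
    -- The strict inequality gives one more place of agreement, so that index `n` is included.
    rw [dist_eq_of_ne hxy, pow_lt_pow_iff_right_of_lt_one₀ hr'.out.1 hr'.out.2] at h
    exact congrArg Fin.val
      (PiNat.apply_eq_of_lt_firstDiff (E := fun _ => Fin (m ^ k)) (hi.trans_lt h))
  · refine ⟨fun n => ⟨a n, ?_⟩, rfl⟩
    cases n
    exacts [ha, ha' _]

end SymbolicSpace

/-- The code is locally constant in each coordinate, so a cluster point of points realizing longer
and longer prefixes realizes the whole sequence. -/
theorem exists_code_eq_of_compact {B : Type*} [MetricSpace B] [CompactSpace B] (F : B → ℕ → ℕ)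
    {c ρ : ℝ} (hc : 0 < c) (hρ : 0 < ρ)
    (hlt : ∀ (x y : B) (n : ℕ), dist x y < c * ρ ^ n → ∀ k ≤ n, F x k = F y k)
    (a : ℕ → ℕ) (ha : ∀ n, ∃ x, ∀ k ≤ n, F x k = a k) : ∃ x, F x = a := by
  choose x hx using ha
  obtain ⟨z, -, φ, hφ, hz⟩ := isCompact_univ.tendsto_subseq fun n => Set.mem_univ (x n)
  refine ⟨z, funext fun k => ?_⟩
  have h1 : ∀ᶠ n in Filter.atTop, dist (x (φ n)) z < c * ρ ^ k :=
    (tendsto_iff_dist_tendsto_zero.1 hz).eventually_lt_const (by positivity)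
  obtain ⟨n, hn, hn'⟩ := (h1.and (Filter.eventually_ge_atTop k)).exists
  rw [← hx (φ n) k (hn'.trans (hφ.id_le n)), hlt _ _ k hn k le_rfl]

/-! ### Distributing weighted items to bins. -/

section Packing

variable {V : Type*} [Fintype V]

open Finset

/-- Distribute `n j` items of weight `u j` to `h` bins so that all bins get the same weight. -/
theorem exists_exact_packing {h : ℕ} (hh : 0 < h) {q : ℕ} {n u : V → ℕ} {c : V → ℤ}
    (hc : ∑ j, c j * u j = 1) (hsum : ∑ j, n j * u j = h * q)
    (hn : ∀ j, c j = 0 ∨ h * (h * (∑ j, u j) * (c j).natAbs + 1) ≤ n j) :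
    ∃ cnt : Fin h → V → ℕ, (∀ j, ∑ b, cnt b j = n j) ∧ ∀ b, ∑ j, cnt b j * u j = q := by
  obtain ⟨g, rfl⟩ : ∃ g, h = g + 1 := ⟨h - 1, by omega⟩
  set U := ∑ j, u j with hU
  set f : V → ℕ := fun j => n j / (g + 1) with hf
  set e : ℤ := q - ∑ j, (f j : ℤ) * u j with he
  have hfn : ∀ j, ((g + 1) * f j : ℤ) + (n j % (g + 1) : ℕ) = n j := fun j => by
    have := Nat.div_add_mod (n j) (g + 1)
    exact_mod_cast this
  have hge : (g + 1 : ℤ) * e = ∑ j, ((n j % (g + 1) : ℕ) : ℤ) * u j := by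
    have h1 : ((∑ j, n j * u j : ℕ) : ℤ) = ((g + 1) * q : ℕ) := congrArg _ hsum
    push_cast at h1
    rw [he, mul_sub, ← h1, mul_sum, ← sum_sub_distrib]
    refine sum_congr rfl fun j _ => ?_
    rw [← hfn j]
    ring
  have he0 : 0 ≤ e := by
    have : 0 ≤ (g + 1 : ℤ) * e := hge ▸ sum_nonneg fun j _ => by positivity
    exact nonneg_of_mul_nonneg_right this (by positivity)
  have heU : e ≤ U := by
    have : (g + 1 : ℤ) * e ≤ (g + 1) * U := by
      rw [hge, hU]
      push_cast
      rw [mul_sum]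
      refine sum_le_sum fun j _ => ?_
      gcongr
      exact_mod_cast (Nat.mod_lt (n j) (Nat.succ_pos g)).le
    exact le_of_mul_le_mul_left this (by positivity)
  -- The floor share `f` misses the weight `q` by `e`, where `0 ≤ e ≤ U`. As `c` has total weight 1,
  -- adding `e * c` repairs this exactly, and the lower bound on `n` keeps all counts nonnegative.
  set z : V → ℤ := fun j => f j + e * c j with hz
  have hzz : ∀ j, 0 ≤ z j ∧ 0 ≤ n j - g * z j := fun j => by
    have hmod : (0 : ℤ) ≤ (n j % (g + 1) : ℕ) := by positivity
    rcases hn j with h0 | hj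
    · have hfj : (0 : ℤ) ≤ f j := by positivity
      simp only [hz, h0, mul_zero, add_zero]
      exact ⟨hfj, by linarith [hfn j]⟩
    · have h1 : (g + 1) * U * (c j).natAbs + 1 ≤ f j :=
        (Nat.le_div_iff_mul_le (Nat.succ_pos g)).2 (by linarith)
      have h2 : ((g + 1) * U * |c j| + 1 : ℤ) ≤ f j := by
        have : (((g + 1) * U * (c j).natAbs + 1 : ℕ) : ℤ) ≤ f j := by exact_mod_cast h1
        push_cast at this
        exact this
      have h3 : |e * c j| ≤ U * |c j| := by
        rw [abs_mul, abs_of_nonneg he0]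
        gcongr
      have h4 := abs_le.1 h3
      have h5 : (0 : ℤ) ≤ g * (U * |c j|) := by positivity
      have h5' : (0 : ℤ) ≤ U * |c j| := by positivity
      have h6 : (g : ℤ) * (e * c j) ≤ g * (U * |c j|) := mul_le_mul_of_nonneg_left h4.2 (by positivity)
      simp only [hz]
      constructor
      · linarith [h4.1]
      · linarith [hfn j]
  have hzu : ∑ j, z j * u j = q := by
    simp only [hz, add_mul, sum_add_distrib, mul_assoc, ← mul_sum, hc]
    rw [he]
    ring
  -- One bin takes what the `g` others leave; its weight is forced by the total.
  refine ⟨Fin.cons (fun j => (n j - g * z j).toNat) fun _ j => (z j).toNat, fun j => ?_,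
    Fin.cases ?_ fun b => ?_⟩
  · zify
    rw [Fin.sum_univ_succ]
    simp only [Fin.cons_zero, Fin.cons_succ, Int.toNat_of_nonneg (hzz j).1,
      Int.toNat_of_nonneg (hzz j).2]
    simp
  · zify
    simp only [Fin.cons_zero, Int.toNat_of_nonneg (hzz _).2, sub_mul, sum_sub_distrib, mul_assoc,
      ← mul_sum, hzu]
    have h1 : ((∑ j, n j * u j : ℕ) : ℤ) = ((g + 1) * q : ℕ) := congrArg _ hsum
    push_cast at h1
    rw [h1]
    ring
  · zify
    simpa only [Fin.cons_succ, Int.toNat_of_nonneg (hzz _).1] using hzu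

/-- Distribute `n j` items of type `j` to `h` bins so that all bins have total lower weight at
most `q` and total upper weight at least `q`. -/
theorem exists_slack_packing {h : ℕ} (hh : 0 < h) {q : ℕ} {n a b : V → ℕ}
    (ha : ∑ j, n j * a j + h * h * ∑ j, a j ≤ h * q)
    (hb : h * q + h * ∑ j, b j ≤ ∑ j, n j * b j) :
    ∃ cnt : Fin h → V → ℕ, (∀ j, ∑ b, cnt b j = n j) ∧
      ∀ i, ∑ j, cnt i j * a j ≤ q ∧ q ≤ ∑ j, cnt i j * b j := by
  obtain ⟨g, rfl⟩ : ∃ g, h = g + 1 := ⟨h - 1, by omega⟩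
  set f : V → ℕ := fun j => n j / (g + 1) with hf
  have hfn : ∀ j, (g + 1) * f j + n j % (g + 1) = n j := fun j => Nat.div_add_mod _ _
  have hmod : ∀ j, n j % (g + 1) < g + 1 := fun j => Nat.mod_lt _ (Nat.succ_pos g)
  obtain ⟨cnt, hcnt, h1, h2⟩ : ∃ cnt : Fin (g + 1) → V → ℕ, (∀ j, ∑ b, cnt b j = n j) ∧
      (∀ i j, f j ≤ cnt i j) ∧ ∀ i j, cnt i j ≤ f j + (g + 1) := by
    -- Every bin gets the floor share and one bin also the remainder, which is less than `g + 1` for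
    -- each type.
    refine ⟨Fin.cons (fun j => n j - g * f j) fun _ j => f j, fun j => ?_,
      Fin.cases (fun j => ?_) fun b j => ?_, Fin.cases (fun j => ?_) fun b j => ?_⟩
    · have := hfn j
      rw [add_mul] at this
      rw [Fin.sum_univ_succ]
      simp
      omega
    · have := hfn j
      rw [add_mul] at this
      simp
      omega
    · simp
    · have := hfn j
      have := hmod j
      rw [add_mul] at *
      simp
      omega
    · simp
  refine ⟨cnt, hcnt, fun i => ⟨?_, ?_⟩⟩
  · refine le_of_mul_le_mul_left ?_ hh
    calc (g + 1) * ∑ j, cnt i j * a j ≤ ∑ j, (n j * a j + (g + 1) * (g + 1) * a j) := by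
          rw [mul_sum]
          refine sum_le_sum fun j _ => ?_
          calc (g + 1) * (cnt i j * a j) ≤ (g + 1) * ((f j + (g + 1)) * a j) := by
                gcongr; exact h2 i j
            _ = ((g + 1) * f j) * a j + (g + 1) * (g + 1) * a j := by ring
            _ ≤ _ := by gcongr; have := hfn j; omega
      _ ≤ _ := by rwa [sum_add_distrib, ← mul_sum]
  · refine le_of_mul_le_mul_left ?_ hh
    refine le_of_add_le_add_right (hb.trans ?_)
    rw [mul_sum, mul_sum, ← sum_add_distrib]
    refine sum_le_sum fun j _ => ?_
    calc n j * b j ≤ ((g + 1) * f j + (g + 1)) * b j := by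
          gcongr; have := hfn j; have := hmod j; omega
      _ ≤ ((g + 1) * cnt i j + (g + 1)) * b j := by gcongr; exact h1 i j
      _ = _ := by ring

end Packing

/-! ### Supports of matrix powers and final classes. -/

section Support

open Finset

theorem Finset.exists_gcd_eq_sum {V : Type*} (s : Finset V) (w : V → ℕ) :
    ∃ c : V → ℤ, ((s.gcd w : ℕ) : ℤ) = ∑ j ∈ s, c j * w j := by
  classical
  induction s using Finset.induction with
  | empty => simp
  | insert a s ha ih =>
    obtain ⟨c, hc⟩ := ih
    refine ⟨fun j => if j = a then Nat.gcdA (w a) (s.gcd w)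
      else c j * Nat.gcdB (w a) (s.gcd w), ?_⟩
    rw [gcd_insert, sum_insert ha]
    simp only [if_true]
    change ((Nat.gcd _ _ : ℕ) : ℤ) = _
    rw [Nat.gcd_eq_gcd_ab, hc, sum_mul, mul_comm]
    congr 1
    refine sum_congr rfl fun j hj => ?_
    rw [if_neg (ne_of_mem_of_not_mem hj ha)]
    ring

variable {V : Type*}

/-- `i` lies in a closed class of the relation `R`, all of whose members are related. -/
def IsFinal (R : V → V → Prop) (i : V) : Prop :=
  R i i ∧ ∀ j, R i j → ∀ k, R j k ↔ R i k

theorem IsFinal.of_rel {R : V → V → Prop} {i j : V} (hi : IsFinal R i) (hij : R i j) :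
    IsFinal R j :=
  ⟨(hi.2 j hij j).2 hij, fun k hk l =>
    (hi.2 k ((hi.2 j hij k).1 hk) l).trans (hi.2 j hij l).symm⟩

variable [Fintype V]

/-- Among the successors of `i`, take one with fewest successors: by transitivity everything it
reaches has the same successors, so any of its successors is final. -/
theorem exists_isFinal {R : V → V → Prop} (ht : ∀ i j k, R i j → R j k → R i k)
    (hs : ∀ i, ∃ j, R i j) (i : V) : ∃ j, R i j ∧ IsFinal R j := by
  classical
  obtain ⟨j, hj, hmin⟩ := (univ.filter fun j => R i j).exists_min_image
    (fun j => #(univ.filter fun k => R j k)) (by simpa [Finset.Nonempty] using hs i)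
  replace hj : R i j := by simpa using hj
  have key : ∀ k, R j k → ∀ l, R k l ↔ R j l := fun k hk => by
    have h1 := eq_of_subset_of_card_le (s := univ.filter fun l => R k l)
      (t := univ.filter fun l => R j l) (fun l hl => by
        simp only [mem_filter, mem_univ, true_and] at hl ⊢
        exact ht j k l hk hl) (hmin k (by simpa using ht i j k hj hk))
    intro l
    simpa using Finset.ext_iff.1 h1 l
  obtain ⟨k, hk⟩ := hs j
  refine ⟨k, ht i j k hj hk, (key k hk k).2 hk, fun l hl p => ?_⟩
  rw [key k hk, key l ((key k hk l).1 hl)]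

theorem Matrix.mul_apply_pos_iff {A B : Matrix V V ℕ} {i j : V} :
    0 < (A * B) i j ↔ ∃ l, 0 < A i l ∧ 0 < B l j := by
  simp [Matrix.mul_apply, pos_iff_ne_zero, sum_eq_zero_iff]

theorem Matrix.exists_pos_of_sum_mul_eq {A : Matrix V V ℕ} {w : V → ℕ} {m : ℕ}
    (hm : 0 < m) (hw : ∀ i, 0 < w i)
    (hA : ∀ i, ∑ j, A i j * w j = m * w i) (i : V) : ∃ j, 0 < A i j := by
  by_contra! h
  have := hA i
  rw [sum_eq_zero fun j _ => by rw [Nat.le_zero.1 (h j), zero_mul]] at this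
  exact (Nat.mul_pos hm (hw i)).ne this

variable [DecidableEq V]

/-- The supports of the powers take finitely many values, hence are eventually periodic. -/
theorem Matrix.exists_pow_support_transitive (A : Matrix V V ℕ) :
    ∃ N, 0 < N ∧ ∀ i j k, 0 < (A ^ N) i j → 0 < (A ^ N) j k → 0 < (A ^ N) i k := by
  obtain ⟨x, y, hne, hxy⟩ := Finite.exists_ne_map_eq_of_infinite
    fun (n : ℕ) (i j : V) => 0 < (A ^ n) i j
  wlog hlt : x < y generalizing x y
  · exact this y x hne.symm hxy.symm (by omega)
  obtain ⟨d, rfl⟩ := Nat.exists_eq_add_of_lt hlt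
  have hstep : ∀ n i j, 0 < (A ^ (x + n)) i j ↔ 0 < (A ^ (x + n + (d + 1))) i j := fun n i j => by
    rw [show x + n + (d + 1) = (x + d + 1) + n by ring, pow_add, pow_add A (x + d + 1),
      mul_apply_pos_iff, mul_apply_pos_iff]
    exact exists_congr fun l => and_congr_left fun _ => Eq.to_iff (congrFun₂ hxy i l)
  have hmul : ∀ k n i j, 0 < (A ^ (x + n)) i j ↔ 0 < (A ^ (x + n + (d + 1) * k)) i j := by
    intro k
    induction k with
    | zero => simp
    | succ k ih =>
      intro n i j
      rw [ih, add_assoc x, hstep, mul_add_one, add_assoc x, add_assoc x, ← add_assoc n]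
  -- A multiple of the period `d + 1` that is past the preperiod `x`: doubling this exponent does
  -- not change the support.
  refine ⟨(d + 1) * (x + 1), by positivity, fun i j k hij hjk => ?_⟩
  have h := hmul (x + 1) ((d + 1) * (x + 1) - x) i k
  have hx : x + ((d + 1) * (x + 1) - x) = (d + 1) * (x + 1) := by
    apply Nat.add_sub_cancel'
    nlinarith
  rw [hx] at h
  rw [h, pow_add, mul_apply_pos_iff]
  exact ⟨j, hij, hjk⟩

variable {A : Matrix V V ℕ} {w : V → ℕ} {m : ℕ}

theorem Matrix.sum_pow_mul_eq (hA : ∀ i, ∑ j, A i j * w j = m * w i) (n : ℕ) (i : V) :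
    ∑ j, (A ^ n) i j * w j = m ^ n * w i := by
  induction n generalizing i with
  | zero => simp [Matrix.one_apply]
  | succ n ih =>
    rw [pow_succ']
    simp only [Matrix.mul_apply, sum_mul]
    rw [sum_comm]
    simp only [mul_assoc, ← mul_sum, ih]
    rw [pow_succ, mul_assoc, ← hA, mul_sum]
    exact sum_congr rfl fun j _ => by ring

theorem IsFinal.rel_of_pow_pos (ht : ∀ i j k, 0 < A i j → 0 < A j k → 0 < A i k) {i : V}
    (hi : IsFinal (fun i j => 0 < A i j) i) {k : ℕ} {l : V}
    (h : 0 < (A ^ k) i l) : 0 < A i l := by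
  induction k generalizing l with
  | zero =>
    obtain rfl : i = l := by
      by_contra hne
      simp [Matrix.one_apply_ne hne] at h
    exact hi.1
  | succ k ih =>
    rw [pow_succ, Matrix.mul_apply_pos_iff] at h
    obtain ⟨l', h1, h2⟩ := h
    exact ht i l' l (ih h1) h2

/-- Some mass of order `m ^ k` sits on the vertices reached after `k` steps, and each of them has an
edge to `j`. -/
theorem IsFinal.eventually_le_pow (ht : ∀ i j k, 0 < A i j → 0 < A j k → 0 < A i k)
    {i j : V} (hi : IsFinal (fun i j => 0 < A i j) i)
    (hm : 2 ≤ m) (hw : ∀ i, 0 < w i) (hA : ∀ i, ∑ j, A i j * w j = m * w i)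
    (hij : 0 < A i j) (D : ℕ) : ∀ᶠ k in Filter.atTop, D ≤ (A ^ k) i j := by
  set W := ∑ l, w l
  have hW : ∀ l, w l ≤ W := fun l => single_le_sum (fun _ _ => Nat.zero_le _) (mem_univ l)
  have key : ∀ k, m ^ k ≤ W * (A ^ (k + 1)) i j := fun k => by
    calc m ^ k ≤ m ^ k * w i := Nat.le_mul_of_pos_right _ (hw i)
      _ = ∑ l, (A ^ k) i l * w l := (Matrix.sum_pow_mul_eq hA k i).symm
      _ ≤ ∑ l, W * ((A ^ k) i l * A l j) := by
          refine sum_le_sum fun l _ => ?_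
          rcases Nat.eq_zero_or_pos ((A ^ k) i l) with h0 | h0
          · simp [h0]
          · have h1 : 0 < A l j := (hi.2 l (hi.rel_of_pow_pos ht h0) j).2 hij
            calc (A ^ k) i l * w l ≤ (A ^ k) i l * W := by gcongr; exact hW l
              _ = W * (A ^ k) i l := mul_comm _ _
              _ ≤ W * ((A ^ k) i l * A l j) := by gcongr; exact Nat.le_mul_of_pos_right _ h1
      _ = W * (A ^ (k + 1)) i j := by rw [pow_succ, Matrix.mul_apply, mul_sum]
  have hlim := (tendsto_pow_atTop_atTop_of_one_lt (show 1 < m by omega)).eventually_ge_atTop (W * D)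
  obtain ⟨K, hK⟩ := Filter.eventually_atTop.1 hlim
  filter_upwards [Filter.eventually_ge_atTop (K + 1)] with k hk
  obtain ⟨k, rfl⟩ : ∃ l, k = l + 1 := ⟨k - 1, by omega⟩
  have hW0 : 0 < W := (hw i).trans_le (hW i)
  exact le_of_mul_le_mul_left ((hK k (by omega)).trans (key k)) hW0

end Support

-- The ranges `[a i, b i]` are the sets of admissible states of the recoding; they are chosen once,
-- before the number `k` of steps, and span a factor of at least `m`.
open Finset in
theorem Matrix.exists_bin_packing {V : Type*} [Fintype V] [DecidableEq V] {A : Matrix V V ℕ}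
    {w : V → ℕ} {m : ℕ} (ht : ∀ i j k, 0 < A i j → 0 < A j k → 0 < A i k)
    (hm : 2 ≤ m) (hw : ∀ i, 0 < w i) (hA : ∀ i, ∑ j, A i j * w j = m * w i) :
    ∃ a b : V → ℕ, (∀ i, 0 < a i ∧ m * a i ≤ b i) ∧ ∀ᶠ k in Filter.atTop,
      ∀ i h, a i ≤ h → h ≤ b i → ∃ cnt : Fin h → V → ℕ, (∀ j, ∑ t, cnt t j = (A ^ k) i j) ∧
        ∀ t, ∑ j, cnt t j * a j ≤ m ^ k ∧ m ^ k ≤ ∑ j, cnt t j * b j := by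
  classical
  set R : V → V → Prop := fun i j => 0 < A i j with hR
  set G : V → ℕ := fun i => (univ.filter fun j => R i j).gcd w with hG
  set W := ∑ l, w l
  have hW : ∀ l, w l ≤ W := fun l => single_le_sum (fun _ _ => Nat.zero_le _) (mem_univ l)
  -- `B` is a power of `m`, for exact packing at the upper end, and so large that `b` at a final
  -- vertex beats every `2 * m * w l`.
  obtain ⟨e, he⟩ : ∃ e, 2 * m * W + 1 ≤ m ^ e :=
    ⟨2 * m * W + 1, (Nat.lt_pow_self (by omega)).le⟩
  set B := m ^ e with hB
  have hmpos : 0 < m := by omega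
  have hGdvd : ∀ i j, R i j → G i ∣ w j := fun i j hij => gcd_dvd (by simpa using hij)
  have hGeq : ∀ i j, IsFinal R i → R i j → G j = G i := fun i j hi hij => by
    simp only [hG, hi.2 j hij]
  -- Dividing by the gcd of the class makes the final weights coprime. The factor 2 elsewhere makes
  -- final vertices relatively cheap, which creates slack.
  set a : V → ℕ := fun i => if IsFinal R i then w i / G i else 2 * w i with ha
  set b : V → ℕ := fun i => if IsFinal R i then B * a i else 2 * m * w i with hb
  have hGa : ∀ i, IsFinal R i → G i * a i = w i := fun i hi => by
    simp only [ha, if_pos hi]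
    exact Nat.mul_div_cancel' (hGdvd i i hi.1)
  have hGpos : ∀ i, IsFinal R i → 0 < G i := fun i hi =>
    Nat.pos_of_ne_zero fun h0 => by
      have := hGa i hi
      rw [h0, zero_mul] at this
      exact (hw i).ne this
  have hapos : ∀ i, 0 < a i := fun i => by
    by_cases hi : IsFinal R i
    · refine Nat.pos_of_ne_zero fun h0 => ?_
      have := hGa i hi
      rw [h0, mul_zero] at this
      exact (hw i).ne this
    · simp only [ha, if_neg hi]
      have := hw i
      omega
  have hale : ∀ i, IsFinal R i → a i ≤ w i := fun i hi => by
    rw [← hGa i hi]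
    exact Nat.le_mul_of_pos_left _ (hGpos i hi)
  have hbB : ∀ i, IsFinal R i → b i = B * a i := fun i hi => if_pos hi
  have hsupp : ∀ i k j, IsFinal R i → 0 < (A ^ k) i j → R i j := fun i k j hi h =>
    hi.rel_of_pow_pos ht h
  have hsum_a : ∀ i k, IsFinal R i → ∑ j, (A ^ k) i j * a j = m ^ k * a i := fun i k hi => by
    refine Nat.eq_of_mul_eq_mul_left (hGpos i hi) ?_
    rw [mul_left_comm, hGa i hi, ← Matrix.sum_pow_mul_eq hA k i, mul_sum]
    refine sum_congr rfl fun j _ => ?_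
    rcases Nat.eq_zero_or_pos ((A ^ k) i j) with h0 | h0
    · simp [h0]
    · have hj := hsupp i k j hi h0
      rw [mul_left_comm, ← hGeq i j hi hj, hGa j (hi.of_rel hj)]
  have hsum_b : ∀ i (n : V → ℕ), IsFinal R i → (∀ j, 0 < n j → R i j) →
      ∑ j, n j * b j = B * ∑ j, n j * a j := fun i n hi hn => by
    rw [mul_sum]
    refine sum_congr rfl fun j _ => ?_
    rcases Nat.eq_zero_or_pos (n j) with h0 | h0
    · simp [h0]
    · rw [hbB j (hi.of_rel (hn j h0))]
      ring
  have hpow : ∀ D, ∀ᶠ k in Filter.atTop, D ≤ m ^ k := fun D =>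
    (tendsto_pow_atTop_atTop_of_one_lt (by omega)).eventually_ge_atTop D
  have hslack : ∀ i h, 0 < h →
      (∀ D, ∀ᶠ k in Filter.atTop, ∑ j, (A ^ k) i j * a j + D ≤ h * m ^ k ∧
        h * m ^ k + D ≤ ∑ j, (A ^ k) i j * b j) →
      ∀ᶠ k in Filter.atTop, ∃ cnt : Fin h → V → ℕ, (∀ j, ∑ t, cnt t j = (A ^ k) i j) ∧
        ∀ t, ∑ j, cnt t j * a j ≤ m ^ k ∧ m ^ k ≤ ∑ j, cnt t j * b j := by
    intro i h hh hD
    filter_upwards [hD (h * h * ∑ j, a j), hD (h * ∑ j, b j)] with k h1 h2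
    exact exists_slack_packing hh h1.1 h2.2
  have hexact : ∀ i, IsFinal R i → ∀ d ≤ e, ∀ᶠ k in Filter.atTop,
      ∃ cnt : Fin (m ^ d * a i) → V → ℕ, (∀ j, ∑ t, cnt t j = (A ^ k) i j) ∧
        ∀ t, ∑ j, cnt t j * a j ≤ m ^ k ∧ m ^ k ≤ ∑ j, cnt t j * b j := by
    intro i hi d hd
    obtain ⟨c₀, hc₀⟩ := exists_gcd_eq_sum (univ.filter fun j => R i j) w
    set c : V → ℤ := fun j => if R i j then c₀ j else 0 with hc
    have hc1 : ∑ j, c j * a j = 1 := by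
      have hG0 : (G i : ℤ) ≠ 0 := by exact_mod_cast (hGpos i hi).ne'
      refine mul_left_cancel₀ hG0 ?_
      rw [mul_one]
      refine Eq.trans ?_ hc₀.symm
      rw [mul_sum, sum_filter]
      refine sum_congr rfl fun j _ => ?_
      simp only [hc]
      split_ifs with hj
      · rw [← hGa j (hi.of_rel hj), hGeq i j hi hj]
        push_cast
        ring
      · simp
    set h := m ^ d * a i with hh
    have hhpos : 0 < h := Nat.mul_pos (pow_pos hmpos d) (hapos i)
    have hn : ∀ᶠ k in Filter.atTop, ∀ j,
        c j = 0 ∨ h * (h * (∑ j, a j) * (c j).natAbs + 1) ≤ (A ^ k) i j := by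
      refine Filter.eventually_all.2 fun j => ?_
      by_cases hj : R i j
      · exact (hi.eventually_le_pow ht hm hw hA hj _).mono fun k hk => Or.inr hk
      · exact Filter.Eventually.of_forall fun k => Or.inl (if_neg hj)
    filter_upwards [hn, Filter.eventually_ge_atTop d] with k hk hdk
    have hkd : m ^ k = m ^ d * m ^ (k - d) := by rw [← pow_add, Nat.add_sub_cancel' hdk]
    obtain ⟨cnt, h1, h2⟩ := exists_exact_packing hhpos (q := m ^ (k - d)) hc1
      (by rw [hsum_a i k hi, hkd, hh]; ring) hk
    refine ⟨cnt, h1, fun t => ⟨?_, ?_⟩⟩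
    · rw [h2, hkd]
      exact Nat.le_mul_of_pos_left _ (pow_pos hmpos d)
    · rw [hsum_b i _ hi, h2, hkd]
      · exact Nat.mul_le_mul_right _ (Nat.pow_le_pow_right hmpos hd)
      · intro j hj
        refine hsupp i k j hi ?_
        rw [← h1]
        exact hj.trans_le (single_le_sum (f := fun t => cnt t j) (fun _ _ => Nat.zero_le _)
          (mem_univ t))
  refine ⟨a, b, fun i => ⟨hapos i, ?_⟩, ?_⟩
  · by_cases hi : IsFinal R i
    · rw [hbB i hi]
      refine Nat.mul_le_mul_right _ ?_
      have := (hw i).trans_le (hW i)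
      nlinarith
    · simp only [ha, hb, if_neg hi]
      exact le_of_eq (by ring)
  refine Filter.eventually_all.2 fun i => ?_
  suffices ∀ h ∈ Icc (a i) (b i), ∀ᶠ k in Filter.atTop,
      ∃ cnt : Fin h → V → ℕ, (∀ j, ∑ t, cnt t j = (A ^ k) i j) ∧
        ∀ t, ∑ j, cnt t j * a j ≤ m ^ k ∧ m ^ k ≤ ∑ j, cnt t j * b j by
    filter_upwards [(Filter.eventually_all_finset _).2 this] with k hk h h1 h2
    exact hk h (mem_Icc.2 ⟨h1, h2⟩)
  intro h hh
  rw [mem_Icc] at hh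
  by_cases hi : IsFinal R i
  · rw [hbB i hi] at hh
    -- At the two ends, `h * m ^ k` equals the total lower or upper weight and the packing has to be
    -- exact; strictly between them the slack is at least `m ^ k`.
    rcases eq_or_lt_of_le hh.1 with h1 | h1
    · have := hexact i hi 0 (Nat.zero_le _)
      rw [pow_zero, one_mul, h1] at this
      exact this
    rcases eq_or_lt_of_le hh.2 with h2 | h2
    · have := hexact i hi e le_rfl
      rw [← hB, ← h2] at this
      exact this
    refine hslack i h (by omega) fun D => ?_
    filter_upwards [hpow D] with k hk
    rw [hsum_b i _ hi fun j hj => hsupp i k j hi hj, hsum_a i k hi]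
    constructor
    · calc m ^ k * a i + D ≤ m ^ k * (a i + 1) := by rw [mul_add, mul_one]; omega
        _ ≤ m ^ k * h := by gcongr; exact h1
        _ = _ := mul_comm _ _
    · calc h * m ^ k + D ≤ (h + 1) * m ^ k := by rw [add_mul, one_mul]; omega
        _ ≤ B * a i * m ^ k := by gcongr; exact h2
        _ = _ := by ring
  · have hai : a i = 2 * w i := if_neg hi
    have hbi : b i = 2 * m * w i := if_neg hi
    -- Each path ending at the final vertex `j` contributes a unit of slack on both sides, and the
    -- number of these paths is unbounded.
    obtain ⟨j, hij, hj⟩ := exists_isFinal ht (Matrix.exists_pos_of_sum_mul_eq hmpos hw hA) i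
    have h1 : ∀ l, a l + (if l = j then 1 else 0) ≤ 2 * w l := fun l => by
      have := hw l
      by_cases hl : IsFinal R l
      · have := hale l hl
        split_ifs <;> omega
      · rw [if_neg (show l ≠ j by rintro rfl; exact hl hj)]
        exact (if_neg hl : a l = _).le
    have h2 : ∀ l, 2 * m * w l + (if l = j then 1 else 0) ≤ b l := fun l => by
      by_cases hl : IsFinal R l
      · rw [hbB l hl]
        calc _ ≤ 2 * m * W + 1 := by gcongr; exacts [hW l, by split_ifs <;> omega]
          _ ≤ B := he
          _ ≤ B * a l := Nat.le_mul_of_pos_right _ (hapos l)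
      · rw [if_neg (show l ≠ j by rintro rfl; exact hl hj)]
        exact (if_neg hl : b l = _).ge
    refine hslack i h ((hapos i).trans_le hh.1) fun D => ?_
    obtain ⟨K, hK⟩ := Filter.eventually_atTop.1 (hj.eventually_le_pow ht hm hw hA hj.1 D)
    filter_upwards [Filter.eventually_ge_atTop (K + 1)] with k hk
    have hD : D ≤ (A ^ k) i j := by
      obtain ⟨k, rfl⟩ : ∃ l, k = l + 1 := ⟨k - 1, by omega⟩
      rw [pow_succ', Matrix.mul_apply]
      calc D ≤ (A ^ k) j j := hK k (by omega)
        _ ≤ A i j * (A ^ k) j j := Nat.le_mul_of_pos_left _ hij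
        _ ≤ _ := single_le_sum (f := fun l => A i l * (A ^ k) l j) (fun _ _ => Nat.zero_le _)
          (mem_univ j)
    have hs : ∑ l, (A ^ k) i l * (if l = j then 1 else 0) = (A ^ k) i j := by simp
    constructor
    · calc ∑ l, (A ^ k) i l * a l + D
          ≤ ∑ l, (A ^ k) i l * a l + ∑ l, (A ^ k) i l * (if l = j then 1 else 0) := by rw [hs]; gcongr
        _ = ∑ l, (A ^ k) i l * (a l + (if l = j then 1 else 0)) := by
            simp only [mul_add, sum_add_distrib]
        _ ≤ ∑ l, (A ^ k) i l * (2 * w l) := by gcongr with l; exact h1 l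
        _ = a i * m ^ k := by
            simp only [mul_left_comm _ 2, ← mul_sum, Matrix.sum_pow_mul_eq hA, hai]
            ring
        _ ≤ h * m ^ k := by gcongr; exact hh.1
    · calc h * m ^ k + D ≤ b i * m ^ k + D := by gcongr; exact hh.2
        _ = ∑ l, (A ^ k) i l * (2 * m * w l) + D := by
            simp only [mul_left_comm _ (2 * m), ← mul_sum, Matrix.sum_pow_mul_eq hA, hbi]
            ring
        _ ≤ ∑ l, (A ^ k) i l * (2 * m * w l) + ∑ l, (A ^ k) i l * (if l = j then 1 else 0) := by
            rw [hs]; gcongr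
        _ = ∑ l, (A ^ k) i l * (2 * m * w l + (if l = j then 1 else 0)) := by
            simp only [mul_add, sum_add_distrib]
        _ ≤ _ := by gcongr with l; exact h2 l

/-! ### Integer eigenvectors by Diophantine approximation. -/

theorem Finite.exists_pos_forall_le {ι : Type*} [Finite ι] {f : ι → ℝ} (hf : ∀ i, 0 < f i) :
    ∃ δ > 0, ∀ i, δ ≤ f i := by
  rcases isEmpty_or_nonempty ι with hι | hι
  · exact ⟨1, one_pos, fun i => hι.elim i⟩
  · obtain ⟨i, hi⟩ := Finite.exists_min f
    exact ⟨f i, hf i, hi⟩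

/-- Simultaneous Diophantine approximation. -/
theorem exists_forall_abs_mul_sub_int_lt {V : Type*} [Fintype V] (v : V → ℝ) {ε : ℝ} (hε : 0 < ε) :
    ∃ N : ℕ, 0 < N ∧ ∃ n : V → ℤ, ∀ i, |N * v i - n i| < ε := by
  obtain ⟨x, -, φ, hφ, hx⟩ := (isCompact_Icc : IsCompact (Set.Icc (0 : V → ℝ) 1)).tendsto_subseq
    (x := fun k i => Int.fract (k * v i))
    fun k => ⟨fun i => Int.fract_nonneg _, fun i => (Int.fract_lt_one _).le⟩
  obtain ⟨K, hK⟩ := Metric.cauchySeq_iff'.1 hx.cauchySeq ε hε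
  -- Two multiples of `v` have nearly equal fractional parts; their difference is nearly integral.
  refine ⟨φ (K + 1) - φ K, Nat.sub_pos_of_lt (hφ K.lt_succ_self),
    fun i => ⌊(φ (K + 1) : ℝ) * v i⌋ - ⌊(φ K : ℝ) * v i⌋, fun i => ?_⟩
  have h := (dist_le_pi_dist _ _ i).trans_lt (hK (K + 1) (Nat.le_succ K))
  rw [Real.dist_eq] at h
  simp only [Function.comp, Int.fract] at h
  rw [Nat.cast_sub (hφ K.lt_succ_self).le]
  push_cast
  refine lt_of_eq_of_lt (congrArg abs ?_) h
  simp only [Nat.succ_eq_add_one]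
  ring

open Finset in
/-- An integer matrix with a positive real eigenvector for an integer eigenvalue has a positive
integer eigenvector. -/
theorem exists_nat_eigenvector {V : Type*} [Fintype V] {A : V → V → ℕ} {m : ℕ} {v : V → ℝ}
    (hv : ∀ i, 0 < v i) (hA : ∀ i, ∑ j, (A i j : ℝ) * v j = m * v i) :
    ∃ w : V → ℕ, (∀ i, 0 < w i) ∧ ∀ i, ∑ j, A i j * w j = m * w i := by
  obtain ⟨δ, hδ, hδv⟩ := Finite.exists_pos_forall_le hv
  set M : ℝ := ∑ i, ∑ j, (A i j : ℝ) + m + 1 with hM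
  have hMpos : 0 < M := by positivity
  obtain ⟨N, hN, n, hn⟩ := exists_forall_abs_mul_sub_int_lt v
    (show 0 < min δ (1 / M) by positivity)
  have hN1 : (1 : ℝ) ≤ N := by exact_mod_cast hN
  have hnpos : ∀ i, 0 < n i := fun i => by
    have h1 := (abs_lt.1 ((hn i).trans_le (min_le_left _ _))).2
    have h2 : v i ≤ N * v i := le_mul_of_one_le_left (hv i).le hN1
    have : (0 : ℝ) < n i := by linarith [hδv i]
    exact_mod_cast this
  have heq : ∀ i, ∑ j, (A i j : ℤ) * n j = m * n i := fun i => by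
    -- The defect of the rounded vector is an integer, and `M` is chosen so that rounding moves it
    -- by less than 1 from its value 0 at `N * v`.
    rw [← sub_eq_zero, ← Int.abs_lt_one_iff]
    have h1 : ((∑ j, (A i j : ℤ) * n j - m * n i : ℤ) : ℝ)
        = m * (N * v i - n i) - ∑ j, (A i j : ℝ) * (N * v j - n j) := by
      push_cast
      simp only [mul_sub, sum_sub_distrib, mul_left_comm _ (N : ℝ), ← mul_sum, hA]
      ring
    have h2 : |((∑ j, (A i j : ℤ) * n j - m * n i : ℤ) : ℝ)| < 1 := by
      rw [h1]
      have h3 : ∀ j, |N * v j - n j| ≤ 1 / M := fun j => ((hn j).trans_le (min_le_right _ _)).le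
      calc _ ≤ |m * (N * v i - n i)| + |∑ j, (A i j : ℝ) * (N * v j - n j)| := abs_sub _ _
        _ ≤ m * (1 / M) + ∑ j, (A i j : ℝ) * (1 / M) := by
            gcongr
            · rw [abs_mul, Nat.abs_cast]
              gcongr
              exact h3 i
            · refine (abs_sum_le_sum_abs _ _).trans (sum_le_sum fun j _ => ?_)
              rw [abs_mul, Nat.abs_cast]
              gcongr
              exact h3 j
        _ = (m + ∑ j, (A i j : ℝ)) / M := by rw [← sum_mul]; ring
        _ < 1 := by
            rw [div_lt_one hMpos, hM]
            have : ∑ j, (A i j : ℝ) ≤ ∑ i, ∑ j, (A i j : ℝ) :=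
              single_le_sum (f := fun i => ∑ j, (A i j : ℝ)) (fun _ _ => by positivity) (mem_univ i)
            linarith
    exact_mod_cast h2
  refine ⟨fun i => (n i).toNat, fun i => by simpa using hnpos i, fun i => ?_⟩
  zify
  simpa only [Int.toNat_of_nonneg (hnpos _).le] using heq i

/-! ### One step of the recoding. -/

section Bins

open Finset

theorem Finset.exists_between_sum_eq {ι : Type*} (s : Finset ι) {a b : ι → ℕ} {q : ℕ}
    (hab : ∀ i ∈ s, a i ≤ b i) (ha : ∑ i ∈ s, a i ≤ q) (hb : q ≤ ∑ i ∈ s, b i) :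
    ∃ η : ι → ℕ, (∀ i ∈ s, a i ≤ η i ∧ η i ≤ b i) ∧ ∑ i ∈ s, η i = q := by
  classical
  induction q, ha using Nat.le_induction with
  | base => exact ⟨a, fun i hi => ⟨le_rfl, hab i hi⟩, rfl⟩
  | succ q _ ih =>
    obtain ⟨η, hη, hsum⟩ := ih (by omega)
    obtain ⟨i, hi, hlt⟩ : ∃ i ∈ s, η i < b i := by
      by_contra! h
      have := sum_le_sum h
      omega
    refine ⟨Function.update η i (η i + 1), fun j hj => ?_, ?_⟩
    · by_cases hji : j = i
      · subst hji
        have := hη j hj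
        simp
        omega
      · simpa [hji] using hη j hj
    · rw [sum_update_of_mem hi, ← hsum, sum_eq_add_sum_sdiff_singleton_of_mem hi η]
      ring

variable {E V : Type*} [Fintype E] [Fintype V] [DecidableEq V]

/-- The edges with a given target are matched with the slots that the counts reserve for that
target. -/
theorem exists_bin_assignment (t : E → V) {h : ℕ} (cnt : Fin h → V → ℕ)
    (hcnt : ∀ j, ∑ s, cnt s j = Fintype.card {e // t e = j}) :
    ∃ β : E → Fin h, ∀ s (g : V → ℕ), ∑ e with β e = s, g (t e) = ∑ j, cnt s j * g j := by
  have hequiv : ∀ j, Nonempty ({e // t e = j} ≃ Σ s, Fin (cnt s j)) := fun j =>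
    Fintype.card_eq.1 (by simp [hcnt])
  let Φ : E ≃ Σ j, Σ s, Fin (cnt s j) :=
    (Equiv.sigmaFiberEquiv t).symm.trans (Equiv.sigmaCongrRight fun j => (hequiv j).some)
  refine ⟨fun e => (Φ e).2.1, fun s g => ?_⟩
  have h1 : ∑ e with (Φ e).2.1 = s, g (t e) =
      ∑ x : Σ j, Σ s, Fin (cnt s j), if x.2.1 = s then g x.1 else 0 := by
    rw [sum_filter]
    exact Fintype.sum_equiv Φ _ _ fun e => rfl
  refine h1.trans ?_
  rw [Fintype.sum_sigma]
  refine sum_congr rfl fun j _ => ?_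
  rw [Fintype.sum_sigma]
  simp

/-- One step of a recoding: the edges `e` are distributed to `h` bins, each of which is split into
`q` cells, `η e` of them belonging to the edge `e`. -/
theorem exists_transition (t : E → V) {h q : ℕ} {a b : V → ℕ} (hab : ∀ j, a j ≤ b j)
    (hbin : ∃ cnt : Fin h → V → ℕ, (∀ j, ∑ s, cnt s j = Fintype.card {e // t e = j}) ∧
      ∀ s, ∑ j, cnt s j * a j ≤ q ∧ q ≤ ∑ j, cnt s j * b j) :
    ∃ (β η : E → ℕ) (dig : E → ℕ → ℕ), (∀ e, β e < h) ∧ (∀ e, a (t e) ≤ η e ∧ η e ≤ b (t e)) ∧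
      (∀ e, ∀ k < η e, dig e k < q) ∧
      (∀ e e' k k', k < η e → k' < η e' → β e = β e' → dig e k = dig e' k' → e = e' ∧ k = k') ∧
      ∀ s < h, ∀ d < q, ∃ e, ∃ k < η e, β e = s ∧ dig e k = d := by
  obtain ⟨cnt, hcnt, hq⟩ := hbin
  obtain ⟨β, hβ⟩ := exists_bin_assignment t cnt hcnt
  choose η hη hsum using fun s => (univ.filter fun e => β e = s).exists_between_sum_eq
    (a := fun e => a (t e)) (b := fun e => b (t e)) (q := q) (fun e _ => hab _)
    ((hβ s a).trans_le (hq s).1) ((hq s).2.trans_eq (hβ s b).symm)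
  have hequiv : ∀ s, Nonempty ((Σ e : {e // β e = s}, Fin (η (β e) e)) ≃ Fin q) := fun s => by
    refine Fintype.card_eq.1 ?_
    rw [Fintype.card_sigma, Fintype.card_fin, ← hsum s,
      sum_subtype (p := fun e => β e = s) _ (fun e => by simp)]
    exact sum_congr rfl fun e _ => by rw [Fintype.card_fin, e.2]
  let Φ := fun s => (hequiv s).some
  have hdig : ∀ e k (hk : k < η (β e) e), ∀ s (hs : β e = s),
      Φ (β e) ⟨⟨e, rfl⟩, ⟨k, hk⟩⟩ = Φ s ⟨⟨e, hs⟩, ⟨k, hk⟩⟩ := fun e k hk s hs => by subst hs; rfl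
  refine ⟨fun e => β e, fun e => η (β e) e,
    fun e k => if hk : k < η (β e) e then Φ (β e) ⟨⟨e, rfl⟩, ⟨k, hk⟩⟩ else 0,
    fun e => (β e).2, fun e => hη (β e) e (by simp), fun e k hk => ?_,
    fun e e' k k' hk hk' hβe hd => ?_, fun s hs d hd => ?_⟩
  · simp only [dif_pos hk]
    exact Fin.is_lt _
  · simp only [dif_pos hk, dif_pos hk'] at hd
    rw [hdig e k hk (β e') (Fin.ext hβe)] at hd
    have := (Φ (β e')).injective (Fin.ext hd)
    simp only [Sigma.mk.injEq, Subtype.mk.injEq] at this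
    obtain ⟨rfl, h2⟩ := this
    exact ⟨rfl, by simpa using h2⟩
  · obtain ⟨⟨⟨e, he⟩, k⟩, hek⟩ := (Φ ⟨s, hs⟩).surjective ⟨d, hd⟩
    refine ⟨e, k, k.2, congrArg Fin.val he, ?_⟩
    dsimp only
    rw [dif_pos k.2, hdig e k k.2 _ he]
    exact congrArg Fin.val hek

end Bins

/-! ### Recoding a dust-like family as a full shift. -/

/-- The output sequence of a transducer with states `(i, h)` that reads the itinerary of a point:
`ed` is the first edge of the itinerary and `tl` is the point with the remaining itinerary. -/
def transduce {V X : Type*} {E : V → Type*} (t : ∀ i, E i → V) (β η : ∀ i, ℕ → E i → ℕ)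
    (dig : ∀ i, ℕ → E i → ℕ → ℕ) (ed : ∀ i, X → E i) (tl : V → X → X) :
    ℕ → V → ℕ → X → ℕ
  | 0, i, h, x => β i h (ed i x)
  | 1, i, h, x => dig i h (ed i x) (β (t i (ed i x)) (η i h (ed i x)) (ed _ (tl i x)))
  | n + 2, i, h, x =>
    transduce t β η dig ed tl (n + 1) (t i (ed i x)) (η i h (ed i x)) (tl i x)

/-- A family `K` of nonempty compact sets, each of which is the disjoint union of the images of
members of the family under similitudes of ratio `ρ`. -/
structure IsDustFamily {V X : Type*} [MetricSpace X] (ρ : ℝ) {E : V → Type*} (t : ∀ i, E i → V)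
    (S : ∀ i, E i → X → X) (K : V → Set X) : Prop where
  dist_S : ∀ i (e : E i) x y, dist (S i e x) (S i e y) = ρ * dist x y
  isCompact : ∀ i, IsCompact (K i)
  nonempty : ∀ i, (K i).Nonempty
  eq_iUnion : ∀ i, K i = ⋃ e : E i, S i e '' K (t i e)
  disjoint : ∀ i, Pairwise fun e e' : E i => Disjoint (S i e '' K (t i e)) (S i e' '' K (t i e'))

namespace IsDustFamily

variable {V X : Type*} [MetricSpace X] {ρ : ℝ} {E : V → Type*} {t : ∀ i, E i → V}
  {S : ∀ i, E i → X → X} {K : V → Set X}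

theorem injective_S (hK : IsDustFamily ρ t S K) (hρ : 0 < ρ) {i : V} (e : E i) :
    Function.Injective (S i e) := fun x y hxy => by
  have := hK.dist_S i e x y
  rw [hxy, dist_self] at this
  exact dist_eq_zero.1 ((mul_eq_zero.1 this.symm).resolve_left hρ.ne')

theorem isCompact_image (hK : IsDustFamily ρ t S K) (hρ : 0 < ρ) {i : V} (e : E i) :
    IsCompact (S i e '' K (t i e)) := by
  refine (hK.isCompact _).image (LipschitzWith.continuous (K := ρ.toNNReal) ?_)
  refine LipschitzWith.of_dist_le_mul fun x y => ?_
  rw [hK.dist_S, Real.coe_toNNReal _ hρ.le]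

/-- Disjoint compact sets are a positive distance apart, and there are finitely many pairs. -/
theorem exists_gap [Finite V] [∀ i, Finite (E i)] (hK : IsDustFamily ρ t S K) (hρ : 0 < ρ) :
    ∃ δ > 0, ∀ i (e e' : E i), ∀ x ∈ S i e '' K (t i e), ∀ y ∈ S i e' '' K (t i e'),
      dist x y < δ → e = e' := by
  have h1 : ∀ p : Σ i, E i × E i, ∃ δ > 0, ∀ x ∈ S _ p.2.1 '' K (t _ p.2.1),
      ∀ y ∈ S _ p.2.2 '' K (t _ p.2.2), dist x y < δ → p.2.1 = p.2.2 := by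
    rintro ⟨i, e, e'⟩
    by_cases hee : e = e'
    · exact ⟨1, one_pos, fun _ _ _ _ _ => hee⟩
    obtain ⟨δ, hδ, h⟩ := Metric.exists_pos_forall_lt_edist (hK.isCompact_image hρ e)
      (hK.isCompact_image hρ e').isClosed (hK.disjoint i hee)
    refine ⟨δ, hδ, fun x hx y hy hxy => absurd (h x hx y hy) (not_lt.2 ?_)⟩
    rw [edist_nndist]
    exact_mod_cast hxy.le
  choose δ hδ h using h1
  obtain ⟨ε, hε, hεδ⟩ := Finite.exists_pos_forall_le hδ
  exact ⟨ε, hε, fun i e e' x hx y hy hxy => h ⟨i, e, e'⟩ x hx y hy (hxy.trans_le (hεδ _))⟩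

theorem exists_diam [Finite V] (hK : IsDustFamily ρ t S K) :
    ∃ D > 0, ∀ i, ∀ x ∈ K i, ∀ y ∈ K i, dist x y ≤ D := by
  obtain ⟨C, hC⟩ := Metric.isBounded_iff.1
    (Bornology.isBounded_iUnion.2 fun i => (hK.isCompact i).isBounded)
  exact ⟨max C 1, by positivity, fun i x hx y hy => (hC (Set.mem_iUnion_of_mem i hx)
    (Set.mem_iUnion_of_mem i hy)).trans (le_max_left _ _)⟩

-- The cell that a point occupies within its edge is its bin in the next state, so two consecutive
-- outputs determine an edge together with the next bin. Hence prefixes of the code and of the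
-- itinerary determine each other up to a shift by one, and both measure distance in powers of `r ^
-- N`.
open SymbolicSpace in
theorem bilipschitzEquivalent [Fintype V] [DecidableEq V] [∀ i, Fintype (E i)] {r : ℝ}
    [hr : Fact (r ∈ Set.Ioo (0 : ℝ) 1)] {m N : ℕ} (hm : 2 ≤ m) (hN : 0 < N)
    (hK : IsDustFamily (r ^ N) t S K) {a b : V → ℕ} (hab : ∀ i, 0 < a i ∧ m * a i ≤ b i)
    (hbin : ∀ i h, a i ≤ h → h ≤ b i → ∃ cnt : Fin h → V → ℕ,
      (∀ j, ∑ s, cnt s j = Fintype.card {e // t i e = j}) ∧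
        ∀ s, ∑ j, cnt s j * a j ≤ m ^ N ∧ m ^ N ≤ ∑ j, cnt s j * b j) (i₀ : V) :
    BilipschitzEquivalent (K i₀) (SymbolicSpace m r) := by
  set ρ := r ^ N with hρ
  have hρ0 : 0 < ρ := pow_pos hr.out.1 N
  have hρ1 : ρ ≤ 1 := pow_le_one₀ hr.out.1.le hr.out.2.le
  obtain ⟨δ, hδ, hgap⟩ := hK.exists_gap hρ0
  obtain ⟨D, hD, hdiam⟩ := hK.exists_diam
  have hab' : ∀ j, a j ≤ b j := fun j => by
    have := (hab j).2
    nlinarith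
  have hE : ∀ i, Nonempty (E i) := fun i => by
    obtain ⟨x, hx⟩ := hK.nonempty i
    rw [hK.eq_iUnion] at hx
    exact ⟨(Set.mem_iUnion.1 hx).choose⟩
  choose! β η dig hβ hη hdig hinj hsurj using fun i h (h1 : a i ≤ h) (h2 : h ≤ b i) =>
    exists_transition (t i) hab' (hbin i h h1 h2)
  have hdec : ∀ i, ∀ x ∈ K i, ∃ (e : E i) (x' : X), x' ∈ K (t i e) ∧ S i e x' = x :=
    fun i x hx => by
      rw [hK.eq_iUnion] at hx
      obtain ⟨e, x', hx', h⟩ := Set.mem_iUnion.1 hx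
      exact ⟨e, x', hx', h⟩
  have hX : ∀ _ : V, Nonempty X := fun i => ⟨(hK.nonempty i).some⟩
  choose! ed tl htl hS using hdec
  set F := transduce t β η dig ed tl with hF
  have hF1 : ∀ i h x, F 1 i h x =
      dig i h (ed i x) (F 0 (t i (ed i x)) (η i h (ed i x)) (tl i x)) := fun i h x => by
    simp only [hF, transduce]
  have hF2 : ∀ n i h x, F (n + 2) i h x =
      F (n + 1) (t i (ed i x)) (η i h (ed i x)) (tl i x) := fun n i h x => by
    simp only [hF, transduce]
  have hmem : ∀ i (e : E i) x', x' ∈ K (t i e) → S i e x' ∈ K i := fun i e x' hx' => by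
    rw [hK.eq_iUnion]
    exact Set.mem_iUnion_of_mem e ⟨x', hx', rfl⟩
  have hedS : ∀ i (e : E i) x', x' ∈ K (t i e) → ed i (S i e x') = e := fun i e x' hx' => by
    have h1 := hmem i e x' hx'
    refine hgap i _ _ _ ⟨_, htl i _ h1, rfl⟩ _ ⟨x', hx', rfl⟩ ?_
    rw [hS i _ h1, dist_self]
    exact hδ
  have htlS : ∀ i (e : E i) x', x' ∈ K (t i e) → tl i (S i e x') = x' := fun i e x' hx' => by
    have h1 := hS i _ (hmem i e x' hx')
    rw [hedS i e x' hx'] at h1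
    exact hK.injective_S hρ0 e h1
  have hF0lt : ∀ i h, a i ≤ h → h ≤ b i → ∀ x, F 0 i h x < h := fun i h h1 h2 x =>
    hβ i h h1 h2 _
  have hFlt : ∀ n i h, a i ≤ h → h ≤ b i → ∀ x ∈ K i, F (n + 1) i h x < m ^ N := by
    intro n
    induction n with
    | zero =>
      intro i h h1 h2 x hx
      rw [zero_add, hF1]
      have h3 := hη i h h1 h2 (ed i x)
      exact hdig i h h1 h2 _ _ (hF0lt _ _ h3.1 h3.2 _)
    | succ n ih =>
      intro i h h1 h2 x hx
      rw [hF2]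
      have h3 := hη i h h1 h2 (ed i x)
      exact ih _ _ h3.1 h3.2 _ (htl i x hx)
  have hle : ∀ n i h, a i ≤ h → h ≤ b i → ∀ x ∈ K i, ∀ y ∈ K i,
      (∀ k ≤ n, F k i h x = F k i h y) → dist x y ≤ D * ρ ^ n := by
    intro n
    induction n with
    | zero =>
      intro i h h1 h2 x hx y hy _
      simpa using hdiam i x hx y hy
    | succ n ih =>
      intro i h h1 h2 x hx y hy hxy
      have e1 := hxy 1 (by omega)
      rw [hF1, hF1] at e1
      have hηx := hη i h h1 h2 (ed i x)
      have hηy := hη i h h1 h2 (ed i y)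
      -- Equal bin and equal digit give the same edge and the same initial output of the tails, so
      -- induction applies to the tails.
      obtain ⟨hed, hk⟩ := hinj i h h1 h2 _ _ _ _ (hF0lt _ _ hηx.1 hηx.2 _)
        (hF0lt _ _ hηy.1 hηy.2 _) (hxy 0 (by omega)) e1
      have hy' := htl i y hy
      have hSy := hS i y hy
      rw [← hed] at hk hy' hSy
      have := ih _ _ hηx.1 hηx.2 _ (htl i x hx) _ hy' fun k hkn => by
        rcases k with _ | k
        · exact hk
        · have := hxy (k + 2) (by omega)
          rwa [hF2, hF2, ← hed] at this
      rw [← hS i x hx, ← hSy, hK.dist_S, pow_succ]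
      calc ρ * dist (tl i x) (tl i y) ≤ ρ * (D * ρ ^ n) := by gcongr
        _ = _ := by ring
  have hlt : ∀ n i h, ∀ x ∈ K i, ∀ y ∈ K i, dist x y < δ * ρ ^ n →
      ∀ k ≤ n, F k i h x = F k i h y := by
    intro n
    induction n with
    | zero =>
      intro i h x hx y hy hxy k hk
      obtain rfl : k = 0 := by omega
      have hed := hgap i _ _ x ⟨_, htl i x hx, hS i x hx⟩ y ⟨_, htl i y hy, hS i y hy⟩
        (by simpa using hxy)
      simp only [hF, transduce, hed]
    | succ n ih =>
      intro i h x hx y hy hxy k hk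
      have hed := hgap i _ _ x ⟨_, htl i x hx, hS i x hx⟩ y ⟨_, htl i y hy, hS i y hy⟩
        (hxy.trans_le (mul_le_of_le_one_right hδ.le (pow_le_one₀ hρ0.le hρ1)))
      have hy' := htl i y hy
      have hSy := hS i y hy
      rw [← hed] at hy' hSy
      have h3 := ih (t i (ed i x)) (η i h (ed i x)) _ (htl i x hx) _ hy' (by
        rw [← hS i x hx, ← hSy, hK.dist_S] at hxy
        refine lt_of_mul_lt_mul_left (hxy.trans_eq ?_) hρ0.le
        ring)
      rcases k with _ | _ | k
      · simp only [hF, transduce, hed]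
      · rw [zero_add, hF1, hF1, ← hed, h3 0 (Nat.zero_le _)]
      · rw [hF2, hF2, ← hed, h3 (k + 1) (by omega)]
  have hdense : ∀ n i h, a i ≤ h → h ≤ b i → ∀ s : ℕ → ℕ, s 0 < h → (∀ k, s (k + 1) < m ^ N) →
      ∃ x ∈ K i, ∀ k ≤ n, F k i h x = s k := by
    intro n
    induction n with
    | zero =>
      intro i h h1 h2 s hs hs'
      obtain ⟨e, k, hk, hβe, -⟩ := hsurj i h h1 h2 (s 0) hs (s 1) (hs' 0)
      obtain ⟨z, hz⟩ := hK.nonempty (t i e)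
      refine ⟨S i e z, hmem i e z hz, fun k hk => ?_⟩
      obtain rfl : k = 0 := by omega
      simp only [hF, transduce, hedS i e z hz, hβe]
    | succ n ih =>
      intro i h h1 h2 s hs hs'
      obtain ⟨e, k, hk, hβe, hd⟩ := hsurj i h h1 h2 (s 0) hs (s 1) (hs' 0)
      have hηe := hη i h h1 h2 e
      -- The tail must start in cell `k` of the edge `e`; the pair `s 0`, `s 1` has been used up to
      -- find `e` and `k`.
      obtain ⟨z, hz, hFz⟩ := ih (t i e) (η i h e) hηe.1 hηe.2
        (fun l => if l = 0 then k else s (l + 1)) (by simpa using hk)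
        fun l => by simpa using hs' (l + 1)
      refine ⟨S i e z, hmem i e z hz, fun l hl => ?_⟩
      rcases l with _ | _ | l
      · simp only [hF, transduce, hedS i e z hz, hβe]
      · rw [zero_add, hF1, hedS i e z hz, htlS i e z hz, hFz 0 (Nat.zero_le _), if_pos rfl, hd]
      · rw [hF2, hedS i e z hz, htlS i e z hz, hFz (l + 1) (by omega), if_neg (by omega)]
  -- The initial state must be a power of `m` so that its symbol consists of whole digits; the range
  -- contains one since `m * a i₀ ≤ b i₀`.
  obtain ⟨T, hT1, hT2⟩ : ∃ T, a i₀ ≤ m ^ T ∧ m ^ T ≤ b i₀ := by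
    refine ⟨Nat.log m (a i₀) + 1, (Nat.lt_pow_succ_log_self (by omega) _).le,
      le_trans ?_ (hab i₀).2⟩
    rw [pow_succ']
    exact Nat.mul_le_mul_left _ (Nat.pow_log_le_self m (hab i₀).1.ne')
  have : CompactSpace (K i₀) := isCompact_iff_compactSpace.1 (hK.isCompact i₀)
  refine bilipschitzEquivalent_of_code (by omega) (fun (x : K i₀) n => F n i₀ (m ^ T) x) T hN hδ hD
    (fun x => hF0lt _ _ hT1 hT2 _) (fun x n => hFlt n _ _ hT1 hT2 x x.2)
    (fun x y => hdiam i₀ x x.2 y y.2) (fun x y n => hle n _ _ hT1 hT2 x x.2 y y.2)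
    (fun x y n => hlt n _ _ x x.2 y y.2) fun s hs hs' => ?_
  refine exists_code_eq_of_compact (fun (x : K i₀) n => F n i₀ (m ^ T) x) hδ hρ0
    (fun x y n => hlt n _ _ x x.2 y y.2) s fun n => ?_
  obtain ⟨x, hx, h⟩ := hdense n i₀ _ hT1 hT2 s hs hs'
  exact ⟨⟨x, hx⟩, h⟩

end IsDustFamily

/-! ### Iterating a graph-directed system. -/

/-- The paths of length `n` in the graph with edges `E i` out of the vertex `i`. -/
def PathsFrom.{u, v} {V : Type v} {E : V → Type u} (t : ∀ i, E i → V) : ℕ → V → Type u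
  | 0, _ => PUnit
  | n + 1, i => Σ e : E i, PathsFrom t n (t i e)

namespace PathsFrom

variable {V X : Type*} {E : V → Type*} {t : ∀ i, E i → V}

/-- The endpoint of a path. -/
def target : ∀ (n : ℕ) (i : V), PathsFrom t n i → V
  | 0, i, _ => i
  | n + 1, i, p => target n (t i p.1) p.2

/-- The composition of the maps along a path. -/
def map (S : ∀ i, E i → X → X) : ∀ (n : ℕ) (i : V), PathsFrom t n i → X → X
  | 0, _, _ => id
  | n + 1, i, p => S i p.1 ∘ map S n (t i p.1) p.2

instance instFintype [∀ i, Fintype (E i)] : ∀ (n : ℕ) (i : V), Fintype (PathsFrom t n i)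
  | 0, _ => inferInstanceAs (Fintype PUnit)
  | n + 1, i =>
    haveI : ∀ e : E i, Fintype (PathsFrom t n (t i e)) := fun e => instFintype n (t i e)
    inferInstanceAs (Fintype (Σ e : E i, PathsFrom t n (t i e)))

open Finset in
theorem card_target_eq [Fintype V] [DecidableEq V] [∀ i, Fintype (E i)] (n : ℕ) (i j : V) :
    Fintype.card {p : PathsFrom t n i // target n i p = j} =
      ((Matrix.of fun i j => Fintype.card {e // t i e = j} : Matrix V V ℕ) ^ n) i j := by
  induction n generalizing i with
  | zero =>
    rw [Fintype.card_subtype, pow_zero, Matrix.one_apply]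
    change #(univ.filter fun _ : PUnit => i = j) = _
    split_ifs with h <;> simp [h]
  | succ n ih =>
    rw [pow_succ', Matrix.mul_apply, Fintype.card_subtype, card_filter]
    change ∑ p : Σ e : E i, PathsFrom t n (t i e),
      (if target n (t i p.1) p.2 = j then 1 else 0) = _
    rw [Fintype.sum_sigma]
    simp only [← card_filter, ← Fintype.card_subtype, ih]
    rw [← sum_fiberwise (s := univ) (g := t i)]
    refine sum_congr rfl fun l _ => ?_
    rw [sum_congr rfl (g := fun _ => ((Matrix.of fun i j => Fintype.card {e // t i e = j} :
      Matrix V V ℕ) ^ n) l j) fun e he => by rw [(mem_filter.1 he).2]]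
    rw [sum_const, smul_eq_mul, Matrix.of_apply, Fintype.card_subtype]

end PathsFrom

theorem IsDustFamily.pow {V X : Type*} [MetricSpace X] {ρ : ℝ} {E : V → Type*} {t : ∀ i, E i → V}
    {S : ∀ i, E i → X → X} {K : V → Set X} (hρ : 0 < ρ) (hK : IsDustFamily ρ t S K) (n : ℕ) :
    IsDustFamily (ρ ^ n) (PathsFrom.target (t := t) n) (PathsFrom.map S n) K := by
  refine ⟨fun i p x y => ?_, hK.isCompact, hK.nonempty, fun i => ?_, fun i => ?_⟩
  · induction n generalizing i with
    | zero => simp [PathsFrom.map]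
    | succ n ih =>
      simp only [PathsFrom.map, Function.comp, hK.dist_S, ih]
      ring
  · induction n generalizing i with
    | zero =>
      change K i = ⋃ _ : PUnit, id '' K i
      rw [Set.image_id, Set.iUnion_const]
    | succ n ih =>
      change K i = ⋃ p : Σ e : E i, PathsFrom t n (t i e),
        (S i p.1 ∘ PathsFrom.map S n (t i p.1) p.2) '' K (PathsFrom.target n (t i p.1) p.2)
      rw [Set.iUnion_sigma, hK.eq_iUnion]
      refine Set.iUnion_congr fun e => ?_
      rw [ih (t i e), Set.image_iUnion]
      exact Set.iUnion_congr fun p => (Set.image_comp _ _ _).symm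
  · induction n generalizing i with
    | zero =>
      intro p p' hne
      exact absurd rfl hne
    | succ n ih =>
      rintro ⟨e, p⟩ ⟨e', p'⟩ hne
      change Disjoint ((S i e ∘ PathsFrom.map S n (t i e) p) '' K (PathsFrom.target n (t i e) p))
        ((S i e' ∘ PathsFrom.map S n (t i e') p') '' K (PathsFrom.target n (t i e') p'))
      rw [Set.image_comp, Set.image_comp]
      by_cases hee : e = e'
      · subst hee
        refine (Set.disjoint_image_iff (hK.injective_S hρ e)).2 (ih (t i e) fun h => hne ?_)
        rw [h]
      · have hsub : ∀ (n : ℕ) (j : V) (q : PathsFrom t n j),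
            PathsFrom.map S n j q '' K (PathsFrom.target n j q) ⊆ K j := by
          intro n
          induction n with
          | zero =>
            intro j q
            change id '' K j ⊆ K j
            simp
          | succ n ih' =>
            intro j q
            change (S j q.1 ∘ PathsFrom.map S n (t j q.1) q.2) ''
              K (PathsFrom.target n (t j q.1) q.2) ⊆ K j
            rw [Set.image_comp, hK.eq_iUnion j]
            exact (Set.image_mono (ih' _ _)).trans
              (Set.subset_iUnion (fun e => S j e '' K (t j e)) q.1)
        exact (hK.disjoint i hee).mono (Set.image_mono (hsub _ _ _))
          (Set.image_mono (hsub _ _ _))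

/-- A dust-like graph-directed set with ratio `r` and integer characteristic `m` is bilipschitz
equivalent to the symbolic space over `m` letters with ratio `r`. -/
theorem bilipschitzEquivalent_symbolicSpace {X : Type*} [MetricSpace X] {r : ℝ}
    [hr : Fact (r ∈ Set.Ioo (0 : ℝ) 1)] {m : ℕ} {K₀ : Set X} (h : K₀ ∈ FractalClassOf X r m) :
    BilipschitzEquivalent K₀ (SymbolicSpace m r) := by
  obtain ⟨G, K, i₀, hK, hdust, ⟨hm, v, hv, hAv⟩, rfl⟩ := h
  let E : Fin G.p → Type := fun i => Σ j, G.E i j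
  let := G.fintypeE
  let t : ∀ i, E i → Fin G.p := fun i e => e.1
  have hdf : IsDustFamily r t (fun i (e : E i) => G.S e.2) K := by
    refine ⟨fun i e x y => G.dist_S _ x y, hK.isCompact, hK.nonempty, fun i => ?_, hdust⟩
    rw [Set.iUnion_sigma]
    exact hK.eq_iUnion i
  set A : Matrix (Fin G.p) (Fin G.p) ℕ := Matrix.of fun i j => Fintype.card {e // t i e = j} with hA
  have hcard : ∀ i j, A i j = Fintype.card (G.E i j) := fun i j =>
    Fintype.card_congr (Equiv.sigmaSubtype j)
  obtain ⟨w, hw, hAw⟩ := exists_nat_eigenvector (A := A) (m := m) hv fun i => by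
    simpa [Matrix.mulVec, dotProduct, GraphSystem.adjMatrix, hcard] using congrFun hAv i
  obtain ⟨N₀, hN₀, htr⟩ := Matrix.exists_pow_support_transitive A
  have hm0 : m ≤ m ^ N₀ := Nat.le_self_pow hN₀.ne' m
  -- The packing is done for `A ^ N₀` with eigenvalue `m ^ N₀`; since `(m ^ N₀) ^ k` is a power of
  -- `m`, the code can still be written with `m` letters.
  obtain ⟨a, b, hab, hev⟩ := Matrix.exists_bin_packing htr (hm.trans hm0) hw
    (Matrix.sum_pow_mul_eq hAw N₀)
  obtain ⟨k, hk, hk0⟩ := (hev.and (Filter.eventually_gt_atTop 0)).exists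
  refine (hdf.pow hr.out.1 (N₀ * k)).bilipschitzEquivalent hm (Nat.mul_pos hN₀ hk0)
    (fun i => ⟨(hab i).1, (Nat.mul_le_mul_right _ hm0).trans (hab i).2⟩) (fun i h h1 h2 => ?_) i₀
  obtain ⟨cnt, hc1, hc2⟩ := hk i h h1 h2
  refine ⟨cnt, fun j => ?_, fun s => ?_⟩
  · rw [hc1, PathsFrom.card_target_eq, pow_mul]
  · rw [pow_mul]
    exact hc2 s

/-! ### Hausdorff measure and dimension of the symbolic spaces. -/

section Hausdorff

open MeasureTheory Filter
open scoped ENNReal NNReal Topology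

namespace SymbolicSpace

variable {m : ℕ} {r : ℝ}

/-- The sequences with a given prefix. -/
def cylinder (n : ℕ) (w : Fin n → Fin m) : Set (SymbolicSpace m r) := {x | ∀ i : Fin n, x i = w i}

/-- Put a prefix in front of a sequence. -/
def prepend {n : ℕ} (w : Fin n → Fin m) (x : SymbolicSpace m r) : SymbolicSpace m r :=
  fun i => if h : i < n then w ⟨i, h⟩ else x (i - n)

theorem range_prepend {n : ℕ} (w : Fin n → Fin m) :
    Set.range (prepend (r := r) w) = cylinder n w := by
  ext x
  constructor
  · rintro ⟨y, rfl⟩ i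
    simp [prepend]
  · intro hx
    refine ⟨fun i => x (i + n), funext fun i => ?_⟩
    by_cases h : i < n
    · simp only [prepend, dif_pos h]
      exact (hx ⟨i, h⟩).symm
    · simp only [prepend, dif_neg h]
      rw [Nat.sub_add_cancel (not_lt.1 h)]

theorem iUnion_cylinder (n : ℕ) : ⋃ w : Fin n → Fin m, cylinder (r := r) n w = Set.univ :=
  Set.eq_univ_of_forall fun x => Set.mem_iUnion.2 ⟨fun i => x i, fun _ => rfl⟩

theorem pairwise_disjoint_cylinder (n : ℕ) :
    Pairwise fun w w' : Fin n → Fin m => Disjoint (cylinder (r := r) n w) (cylinder n w') :=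
  fun _ _ hne => Set.disjoint_left.2 fun _ hx hx' =>
    hne (funext fun i => (hx i).symm.trans (hx' i))

variable [hr : Fact (r ∈ Set.Ioo (0 : ℝ) 1)]

theorem dist_prepend {n : ℕ} (w : Fin n → Fin m) (x y : SymbolicSpace m r) :
    dist (prepend w x) (prepend w y) = r ^ n * dist x y := by
  have key : ∀ l, dist (prepend w x) (prepend w y) ≤ r ^ (n + l) ↔ dist x y ≤ r ^ l := fun l => by
    rw [dist_le_pow_iff, dist_le_pow_iff]
    constructor
    · intro h i hi
      simpa [prepend] using h (n + i) (by omega)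
    · intro h i hi
      by_cases hin : i < n
      · simp [prepend, hin]
      · simpa [prepend, hin] using h (i - n) (by omega)
  by_cases hxy : x = y
  · simp [hxy]
  obtain ⟨l, hl, hne⟩ := exists_dist_eq_pow hxy
  refine le_antisymm ?_ ?_
  · rw [hl, ← pow_add, key, hl]
  · have hne' : prepend w x ≠ prepend w y := fun h => hne <| by
      simpa [prepend] using congrFun h (n + l)
    obtain ⟨l', hl', -⟩ := exists_dist_eq_pow hne'
    have h1 : n ≤ l' := by
      rw [← pow_le_pow_iff_right_of_lt_one₀ hr.out.1 hr.out.2, ← hl', dist_le_pow_iff]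
      intro i hi
      simp [prepend, hi]
    obtain ⟨l'', rfl⟩ := Nat.exists_eq_add_of_le h1
    rw [hl', pow_add]
    gcongr
    exact pow_nonneg hr.out.1.le _
    exact (key l'').1 hl'.le

theorem isOpen_of_saturated {U : Set (SymbolicSpace m r)} {n : ℕ}
    (hU : ∀ x ∈ U, ∀ y : SymbolicSpace m r, (∀ i < n, x i = y i) → y ∈ U) : IsOpen U :=
  Metric.isOpen_iff.2 fun x hx => ⟨r ^ n, pow_pos hr.out.1 n, fun y hy =>
    hU x hx y (dist_le_pow_iff.1 (by rw [dist_comm]; exact (Metric.mem_ball.1 hy).le))⟩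

theorem isOpen_cylinder (n : ℕ) (w : Fin n → Fin m) : IsOpen (cylinder (r := r) n w) :=
  isOpen_of_saturated (n := n) fun _ hx _ hxy i => (hxy i i.2).symm.trans (hx i)

noncomputable instance instMeasurableSpace : MeasurableSpace (SymbolicSpace m r) := borel _

instance instBorelSpace : BorelSpace (SymbolicSpace m r) := ⟨rfl⟩

theorem ediam_cylinder_le (n : ℕ) (w : Fin n → Fin m) :
    Metric.ediam (cylinder (r := r) n w) ≤ ENNReal.ofReal (r ^ n) :=
  Metric.ediam_le fun x hx y hy => by
    rw [edist_dist]
    exact ENNReal.ofReal_le_ofReal (dist_le_pow_iff.2 fun i hi =>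
      (hx ⟨i, hi⟩).trans (hy ⟨i, hi⟩).symm)

variable {s : ℝ}

theorem ofReal_pow_rpow (hrs : r ^ s = (m : ℝ)⁻¹) (hm : 2 ≤ m) (n : ℕ) :
    ENNReal.ofReal (r ^ n) ^ s = ((m : ℝ≥0∞) ^ n)⁻¹ := by
  have hr0 := hr.out.1
  rw [ENNReal.ofReal_rpow_of_pos (pow_pos hr0 n), ← Real.rpow_natCast, ← Real.rpow_mul hr0.le,
    mul_comm, Real.rpow_mul hr0.le, hrs, Real.rpow_natCast, inv_pow,
    ENNReal.ofReal_inv_of_pos (by positivity), ENNReal.ofReal_pow (by positivity),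
    ENNReal.ofReal_natCast]

/-- The `m ^ n` cylinders of length `n` each contribute at most `m ^ (-n)` to the covering sum. -/
theorem hausdorffMeasure_univ_ne_top (hs : 0 < s) (hrs : r ^ s = (m : ℝ)⁻¹) (hm : 2 ≤ m) :
    μH[s] (Set.univ : Set (SymbolicSpace m r)) ≠ ∞ := by
  have hlim : Tendsto (fun n : ℕ => ENNReal.ofReal (r ^ n)) atTop (𝓝 0) := by
    rw [← ENNReal.ofReal_zero]
    exact ENNReal.tendsto_ofReal (tendsto_pow_atTop_nhds_zero_of_lt_one hr.out.1.le hr.out.2)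
  have h := Measure.hausdorffMeasure_le_liminf_sum s (Set.univ : Set (SymbolicSpace m r)) _ hlim
    (fun n (w : Fin n → Fin m) => cylinder n w)
    (Eventually.of_forall fun n w => ediam_cylinder_le n w)
    (Eventually.of_forall fun n => (iUnion_cylinder n).ge)
  refine ne_top_of_le_ne_top ENNReal.one_ne_top (h.trans ?_)
  have h1 : ∀ n : ℕ, ∑ w : Fin n → Fin m, Metric.ediam (cylinder (r := r) n w) ^ s ≤ 1 := fun n => by
    calc _ ≤ ∑ _w : Fin n → Fin m, ((m : ℝ≥0∞) ^ n)⁻¹ := by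
          refine Finset.sum_le_sum fun w _ => ?_
          rw [← ofReal_pow_rpow hrs hm n]
          exact ENNReal.rpow_le_rpow (ediam_cylinder_le n w) hs.le
      _ = 1 := by
          rw [Finset.sum_const, nsmul_eq_mul, Finset.card_univ, Fintype.card_fun, Fintype.card_fin,
            Fintype.card_fin, Nat.cast_pow]
          refine ENNReal.mul_inv_cancel (pow_ne_zero _ ?_) (ENNReal.pow_ne_top (by simp))
          exact_mod_cast (by omega : m ≠ 0)
  calc _ ≤ liminf (fun _ : ℕ => (1 : ℝ≥0∞)) atTop := liminf_le_liminf (Eventually.of_forall h1)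
    _ = 1 := liminf_const 1

/-- Reading a sequence as a base `m` expansion is Hölder of exponent `s` and maps onto the unit
interval, which has length 1. -/
theorem hausdorffMeasure_univ_ne_zero (hs : 0 < s) (hrs : r ^ s = (m : ℝ)⁻¹) (hm : 2 ≤ m) :
    μH[s] (Set.univ : Set (SymbolicSpace m r)) ≠ 0 := by
  have hr0 := hr.out.1
  have hh : HolderOnWith 1 s.toNNReal (fun x : SymbolicSpace m r => Real.ofDigits (b := m) x)
      Set.univ := by
    intro x _ y _
    by_cases hxy : x = y
    · simp [hxy]
    rw [ENNReal.coe_one, one_mul, edist_dist, edist_dist, dist_eq_of_ne hxy,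
      Real.coe_toNNReal _ hs.le, ofReal_pow_rpow hrs hm]
    rw [← ENNReal.ofReal_natCast, ← ENNReal.ofReal_pow (by positivity),
      ← ENNReal.ofReal_inv_of_pos (by positivity)]
    refine ENNReal.ofReal_le_ofReal ?_
    rw [Real.dist_eq]
    exact Real.abs_ofDigits_sub_ofDigits_le fun i hi =>
      PiNat.apply_eq_of_lt_firstDiff (E := fun _ => Fin m) hi
  have h1 := hh.hausdorffMeasure_image_le (Real.toNNReal_pos.2 hs) (zero_le_one' ℝ)
  rw [Real.coe_toNNReal _ hs.le, mul_one, ENNReal.coe_one, ENNReal.one_rpow, one_mul,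
    hausdorffMeasure_real] at h1
  have h2 : (1 : ℝ≥0∞) ≤ volume
      ((fun x : SymbolicSpace m r => Real.ofDigits (b := m) x) '' Set.univ) := by
    calc (1 : ℝ≥0∞) = volume (Set.Icc (0 : ℝ) 1) := by simp
      _ ≤ _ := measure_mono (Real.ofDigits_SurjOn (by omega))
  exact (zero_lt_one.trans_le (h2.trans h1)).ne'

/-- A cylinder is a copy of the whole space scaled by `r ^ n`. -/
theorem hausdorffMeasure_cylinder (hs : 0 < s) (hrs : r ^ s = (m : ℝ)⁻¹) (hm : 2 ≤ m) (n : ℕ)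
    (w : Fin n → Fin m) :
    μH[s] (cylinder (r := r) n w) =
      ((m : ℝ≥0∞) ^ n)⁻¹ * μH[s] (Set.univ : Set (SymbolicSpace m r)) := by
  have hr0 := hr.out.1
  have hm0 : (m : ℝ≥0∞) ^ n ≠ 0 := pow_ne_zero _ (by exact_mod_cast (by omega : m ≠ 0))
  have hmt : (m : ℝ≥0∞) ^ n ≠ ∞ := ENNReal.pow_ne_top (by simp)
  rw [← range_prepend, ← Set.image_univ]
  refine le_antisymm ?_ ?_
  · have h1 : LipschitzWith (r ^ n).toNNReal (prepend (r := r) w) :=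
      .of_dist_le_mul fun x y => by
        rw [dist_prepend, Real.coe_toNNReal _ (pow_nonneg hr0.le n)]
    have := h1.hausdorffMeasure_image_le hs.le Set.univ
    rwa [← ofReal_pow_rpow hrs hm n]
  · have h1 : AntilipschitzWith (r ^ n).toNNReal⁻¹ (prepend (r := r) w) :=
      .of_le_mul_dist fun x y => by
        rw [dist_prepend, NNReal.coe_inv, Real.coe_toNNReal _ (pow_nonneg hr0.le n),
          inv_mul_cancel_left₀ (pow_pos hr0 n).ne']
    have := h1.le_hausdorffMeasure_image hs.le Set.univ
    rw [ENNReal.coe_inv (Real.toNNReal_pos.2 (pow_pos hr0 n)).ne', ENNReal.inv_rpow] at this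
    change _ ≤ (ENNReal.ofReal (r ^ n) ^ s)⁻¹ * _ at this
    rw [ofReal_pow_rpow hrs hm n, inv_inv] at this
    rwa [mul_comm, ← div_eq_mul_inv, ENNReal.div_le_iff_le_mul (Or.inl hm0) (Or.inl hmt), mul_comm]

/-- A set that is a union of cylinders of length `n` has Hausdorff measure an integer multiple of
that of a cylinder. -/
theorem exists_hausdorffMeasure_eq (hs : 0 < s) (hrs : r ^ s = (m : ℝ)⁻¹) (hm : 2 ≤ m)
    {U : Set (SymbolicSpace m r)} {n : ℕ}
    (hU : ∀ x ∈ U, ∀ y : SymbolicSpace m r, (∀ i < n, x i = y i) → y ∈ U) :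
    ∃ M : ℕ, (μH[s] U).toReal =
      M * (μH[s] (Set.univ : Set (SymbolicSpace m r))).toReal / (m : ℝ) ^ n := by
  classical
  let T : Finset (Fin n → Fin m) := Finset.univ.filter fun w => cylinder n w ⊆ U
  have hUT : U = ⋃ w ∈ T, cylinder n w := by
    ext x
    simp only [Set.mem_iUnion, T, Finset.mem_filter, Finset.mem_univ, true_and, exists_prop]
    constructor
    · intro hx
      exact ⟨fun i => x i, fun y hy => hU x hx y fun i hi => (hy ⟨i, hi⟩).symm, fun _ => rfl⟩
    · rintro ⟨w, hw, hx⟩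
      exact hw hx
  refine ⟨T.card, ?_⟩
  rw [hUT, measure_biUnion_finset (fun w _ w' _ hne => pairwise_disjoint_cylinder n hne)
    fun w _ => (isOpen_cylinder n w).measurableSet]
  simp only [hausdorffMeasure_cylinder hs hrs hm, Finset.sum_const, nsmul_eq_mul,
    ENNReal.toReal_mul, ENNReal.toReal_natCast, ENNReal.toReal_inv, ENNReal.toReal_pow]
  ring

theorem rpow_log_div_log (hm : 2 ≤ m) : r ^ (Real.log m / -Real.log r) = (m : ℝ)⁻¹ := by
  have hr0 := hr.out.1
  have hlog : Real.log r ≠ 0 := (Real.log_neg hr0 hr.out.2).ne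
  have hm0 : (0 : ℝ) < m := by positivity
  rw [Real.rpow_def_of_pos hr0, ← Real.exp_log (inv_pos.2 hm0), Real.log_inv]
  congr 1
  field_simp

theorem log_div_log_pos (r : ℝ) [hr : Fact (r ∈ Set.Ioo (0 : ℝ) 1)] (hm : 2 ≤ m) :
    0 < Real.log m / -Real.log r :=
  div_pos (Real.log_pos (by exact_mod_cast hm)) (neg_pos.2 (Real.log_neg hr.out.1 hr.out.2))

theorem dimH_univ (hm : 2 ≤ m) :
    dimH (Set.univ : Set (SymbolicSpace m r)) = ENNReal.ofReal (Real.log m / -Real.log r) := by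
  have hs := log_div_log_pos r hm
  have hrs := rpow_log_div_log (r := r) hm
  refine dimH_of_hausdorffMeasure_ne_zero_ne_top (d := (Real.log m / -Real.log r).toNNReal) ?_ ?_
  · rw [Real.coe_toNNReal _ hs.le]
    exact hausdorffMeasure_univ_ne_zero hs hrs hm
  · rw [Real.coe_toNNReal _ hs.le]
    exact hausdorffMeasure_univ_ne_top hs hrs hm

end SymbolicSpace

end Hausdorff

/-! ### Rigidity of bilipschitz maps between symbolic spaces. -/

section Rigidity

open MeasureTheory Filter

theorem BilipschitzEquivalent.dimH_univ_eq {B B' : Type*} [MetricSpace B] [MetricSpace B']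
    (h : BilipschitzEquivalent B B') : dimH (Set.univ : Set B) = dimH (Set.univ : Set B') := by
  obtain ⟨f, C, hC, h⟩ := h
  have h1 : LipschitzWith C.toNNReal f := .of_dist_le_mul fun x y => by
    rw [Real.coe_toNNReal _ hC.le]
    exact (h x y).2
  have h2 : AntilipschitzWith C.toNNReal f := .of_le_mul_dist fun x y => by
    rw [Real.coe_toNNReal _ hC.le, ← inv_mul_le_iff₀ hC]
    exact (h x y).1
  have h3 : f '' Set.univ = Set.univ := by rw [Set.image_univ, f.surjective.range_eq]
  refine le_antisymm ?_ ?_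
  · simpa only [h3] using h2.le_dimH_image Set.univ
  · simpa only [h3] using h1.dimH_image_le Set.univ

namespace SymbolicSpace

theorem cylinder_eq_iUnion_snoc {m : ℕ} {r : ℝ} {n : ℕ} (w : Fin n → Fin m) :
    cylinder (r := r) n w = ⋃ d : Fin m, cylinder (n + 1) (Fin.snoc w d : Fin (n + 1) → Fin m) := by
  ext x
  simp [cylinder, Fin.forall_fin_succ']

/-- The Falconer-Marsh rigidity of bilipschitz maps. -/
theorem exists_pow_eq_of_bilipschitzEquivalent {m₁ m₂ : ℕ} {r₁ r₂ : ℝ}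
    [hr₁ : Fact (r₁ ∈ Set.Ioo (0 : ℝ) 1)] [hr₂ : Fact (r₂ ∈ Set.Ioo (0 : ℝ) 1)]
    (hm₁ : 2 ≤ m₁) (hm₂ : 2 ≤ m₂)
    (h : BilipschitzEquivalent (SymbolicSpace m₁ r₁) (SymbolicSpace m₂ r₂)) :
    ∃ k₁ k₂ : ℕ, 1 ≤ k₁ ∧ 1 ≤ k₂ ∧ r₁ ^ k₁ = r₂ ^ k₂ ∧ m₁ ^ k₁ = m₂ ^ k₂ := by
  have hr₁0 := hr₁.out.1
  have hr₂0 := hr₂.out.1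
  have hm₁0 : (0 : ℝ) < m₁ := by positivity
  have hm₂0 : (0 : ℝ) < m₂ := by positivity
  have hm₂1 : (1 : ℝ) ≤ m₂ := by exact_mod_cast (by omega : 1 ≤ m₂)
  have hlog₁ : Real.log r₁ < 0 := Real.log_neg hr₁0 hr₁.out.2
  have hlog₂ : Real.log r₂ < 0 := Real.log_neg hr₂0 hr₂.out.2
  set s := Real.log m₁ / -Real.log r₁ with hs_def
  have hs : 0 < s := log_div_log_pos r₁ hm₁
  have hs_eq : s = Real.log m₂ / -Real.log r₂ := by
    have h1 := h.dimH_univ_eq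
    rw [dimH_univ hm₁, dimH_univ hm₂] at h1
    exact (ENNReal.ofReal_eq_ofReal_iff hs.le (log_div_log_pos r₂ hm₂).le).1 h1
  have hrs₁ : r₁ ^ s = (m₁ : ℝ)⁻¹ := rpow_log_div_log hm₁
  have hrs₂ : r₂ ^ s = (m₂ : ℝ)⁻¹ := hs_eq ▸ rpow_log_div_log hm₂
  -- Because the dimensions agree, the same exponent carries `r₂` to `r₁` and `m₂` to `m₁`.
  set θ := Real.log r₁ / Real.log r₂ with hθ
  have hθ0 : 0 ≤ θ := (div_pos_of_neg_of_neg hlog₁ hlog₂).le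
  have hrθ : r₂ ^ θ = r₁ := by
    rw [Real.rpow_def_of_pos hr₂0, hθ, mul_div_cancel₀ _ hlog₂.ne, Real.exp_log hr₁0]
  have hmθ : (m₂ : ℝ) ^ θ = m₁ := by
    rw [← inv_inv (m₂ : ℝ), ← hrs₂, Real.inv_rpow (by positivity), ← Real.rpow_mul hr₂0.le,
      mul_comm, Real.rpow_mul hr₂0.le, hrθ, hrs₁, inv_inv]
  obtain ⟨f, C, hC, hf⟩ := h
  obtain ⟨k₀, hk₀⟩ : ∃ k₀ : ℕ, C * r₂ ^ k₀ ≤ 1 := by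
    obtain ⟨k₀, hk₀⟩ := exists_pow_lt_of_lt_one (inv_pos.2 hC) hr₂.out.2
    exact ⟨k₀, by rw [← le_div_iff₀' hC, one_div]; exact hk₀.le⟩
  -- At depth `k n` the target is fine enough for images of `n`-cylinders to be unions of cylinders,
  -- yet `m₂ ^ k n` exceeds `m₁ ^ n` by at most a constant factor.
  set k : ℕ → ℕ := fun n => ⌈θ * n⌉₊ + k₀ with hk
  have hk_mono : Monotone k := fun a b hab => by
    simp only [hk]
    gcongr
  have hCk : ∀ n, C * r₂ ^ k n ≤ r₁ ^ n := fun n => by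
    have h1 : r₂ ^ ⌈θ * n⌉₊ ≤ r₁ ^ n := by
      rw [← Real.rpow_natCast, ← hrθ, ← Real.rpow_natCast, ← Real.rpow_mul hr₂0.le]
      exact Real.rpow_le_rpow_of_exponent_ge hr₂0 hr₂.out.2.le (Nat.le_ceil _)
    calc C * r₂ ^ k n = r₂ ^ ⌈θ * n⌉₊ * (C * r₂ ^ k₀) := by simp only [hk, pow_add]; ring
      _ ≤ r₁ ^ n * 1 := by gcongr
      _ = _ := mul_one _
  have hmk : ∀ n, (m₂ : ℝ) ^ k n ≤ (m₁ : ℝ) ^ n * (m₂ : ℝ) ^ (k₀ + 1) := fun n => by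
    have h1 : (m₂ : ℝ) ^ ⌈θ * n⌉₊ ≤ (m₁ : ℝ) ^ n * m₂ := by
      rw [← hmθ, ← Real.rpow_natCast, ← Real.rpow_natCast (_ ^ θ), ← Real.rpow_mul hm₂0.le]
      nth_rewrite 3 [← Real.rpow_one (m₂ : ℝ)]
      rw [← Real.rpow_add hm₂0]
      exact Real.rpow_le_rpow_of_exponent_le hm₂1 (Nat.ceil_lt_add_one (by positivity)).le
    calc (m₂ : ℝ) ^ k n = (m₂ : ℝ) ^ ⌈θ * n⌉₊ * (m₂ : ℝ) ^ k₀ := by simp only [hk, pow_add]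
      _ ≤ (m₁ : ℝ) ^ n * m₂ * (m₂ : ℝ) ^ k₀ := by gcongr
      _ = _ := by ring
  have hsat : ∀ n (w : Fin n → Fin m₁), ∀ z ∈ f '' cylinder n w, ∀ y : SymbolicSpace m₂ r₂,
      (∀ i < k n, z i = y i) → y ∈ f '' cylinder n w := by
    rintro n w _ ⟨x, hx, rfl⟩ y hy
    refine ⟨f.symm y, fun i => ?_, f.apply_symm_apply y⟩
    have h1 := (hf x (f.symm y)).1
    rw [f.apply_symm_apply, inv_mul_le_iff₀ hC] at h1
    have h2 : dist x (f.symm y) ≤ r₁ ^ n := by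
      refine h1.trans (le_trans ?_ (hCk n))
      gcongr
      exact dist_le_pow_iff.2 hy
    rw [← dist_le_pow_iff.1 h2 i i.2, hx i]
  set H₁ := (μH[s] (Set.univ : Set (SymbolicSpace m₁ r₁))).toReal with hH₁
  set H₂ := (μH[s] (Set.univ : Set (SymbolicSpace m₂ r₂))).toReal with hH₂
  have hfin₁ := hausdorffMeasure_univ_ne_top (r := r₁) hs hrs₁ hm₁
  have hfin₂ := hausdorffMeasure_univ_ne_top (r := r₂) hs hrs₂ hm₂
  have hH₁0 : 0 < H₁ := ENNReal.toReal_pos (hausdorffMeasure_univ_ne_zero hs hrs₁ hm₁) hfin₁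
  have hH₂0 : 0 < H₂ := ENNReal.toReal_pos (hausdorffMeasure_univ_ne_zero hs hrs₂ hm₂) hfin₂
  have hlip : LipschitzWith C.toNNReal f := .of_dist_le_mul fun x y => by
    rw [Real.coe_toNNReal _ hC.le]
    exact (hf x y).2
  have hanti : AntilipschitzWith C.toNNReal f := .of_le_mul_dist fun x y => by
    rw [Real.coe_toNNReal _ hC.le, ← inv_mul_le_iff₀ hC]
    exact (hf x y).1
  have hfinU : ∀ U : Set (SymbolicSpace m₂ r₂), μH[s] U ≠ ⊤ := fun U =>
    ne_top_of_le_ne_top hfin₂ (measure_mono (Set.subset_univ U))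
  -- the density of the pullback of the Hausdorff measure, on cylinders
  set ν : ∀ n, (Fin n → Fin m₁) → ℝ :=
    fun n w => (μH[s] (f '' cylinder n w)).toReal * (m₁ : ℝ) ^ n with hν
  have hCs : ((C.toNNReal : ENNReal) ^ s) ≠ ⊤ := ENNReal.rpow_ne_top_of_nonneg hs.le (by simp)
  have hcyl : ∀ n (w : Fin n → Fin m₁),
      (μH[s] (cylinder (r := r₁) n w)).toReal * (m₁ : ℝ) ^ n = H₁ := fun n w => by
    rw [hausdorffMeasure_cylinder hs hrs₁ hm₁, ENNReal.toReal_mul, ENNReal.toReal_inv,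
      ENNReal.toReal_pow, ENNReal.toReal_natCast, mul_comm, ← mul_assoc,
      mul_inv_cancel₀ (by positivity), one_mul]
  have hν_le : ∀ n w, ν n w ≤ ((C.toNNReal : ENNReal) ^ s).toReal * H₁ := fun n w => by
    rw [← hcyl n w, ← mul_assoc, ← ENNReal.toReal_mul]
    refine mul_le_mul_of_nonneg_right (ENNReal.toReal_mono ?_ ?_) (by positivity)
    · exact ENNReal.mul_ne_top hCs (ne_top_of_le_ne_top hfin₁ (measure_mono (Set.subset_univ _)))
    · exact hlip.hausdorffMeasure_image_le hs.le _
  have hν_pos : ∀ n w, 0 < ν n w := fun n w => by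
    refine mul_pos (ENNReal.toReal_pos (fun h0 => ?_) (hfinU _)) (by positivity)
    have h1 := hanti.le_hausdorffMeasure_image hs.le (cylinder n w)
    rw [h0, mul_zero, nonpos_iff_eq_zero] at h1
    have h2 := hcyl n w
    rw [h1] at h2
    simp only [ENNReal.toReal_zero, zero_mul] at h2
    exact hH₁0.ne h2
  have hν_sum : ∀ n w,
      ∑ d : Fin m₁, ν (n + 1) (Fin.snoc w d : Fin (n + 1) → Fin m₁) = m₁ * ν n w := by
    intro n w
    have h1 : μH[s] (f '' cylinder n w) =
        ∑ d : Fin m₁, μH[s] (f '' cylinder (n + 1) (Fin.snoc w d : Fin (n + 1) → Fin m₁)) := by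
      rw [cylinder_eq_iUnion_snoc, Set.image_iUnion, measure_iUnion, tsum_fintype]
      · intro d d' hdd
        refine (Set.disjoint_image_iff f.injective).2 (pairwise_disjoint_cylinder _ fun h => hdd ?_)
        simpa using congrFun h (Fin.last n)
      · exact fun d => (isOpen_of_saturated (hsat _ _)).measurableSet
    simp only [hν]
    rw [h1, ENNReal.toReal_sum fun d _ => hfinU _, ← Finset.sum_mul]
    ring
  choose M hM using fun n w => exists_hausdorffMeasure_eq hs hrs₂ hm₂ (hsat n w)
  have hνM : ∀ n w, ν n w = M n w * (H₂ * ((m₁ : ℝ) ^ n / (m₂ : ℝ) ^ k n)) := fun n w => by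
    simp only [hν, hM, hH₂]
    ring
  have hscale : ∀ n, ((m₂ : ℝ) ^ (k₀ + 1))⁻¹ ≤ (m₁ : ℝ) ^ n / (m₂ : ℝ) ^ k n := fun n => by
    rw [inv_eq_one_div, div_le_div_iff₀ (by positivity) (by positivity), one_mul]
    exact hmk n
  set σ := sSup (Set.range fun p : Σ n, Fin n → Fin m₁ => ν p.1 p.2) with hσ
  have hbdd : BddAbove (Set.range fun p : Σ n, Fin n → Fin m₁ => ν p.1 p.2) :=
    ⟨_, by rintro _ ⟨p, rfl⟩; exact hν_le _ _⟩
  have hνσ : ∀ n w, ν n w ≤ σ := fun n w => le_csSup hbdd ⟨⟨n, w⟩, rfl⟩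
  -- A lower bound for the gap between distinct densities of a cylinder and of its child: both are
  -- integer multiples of one quantity that is at least `η`.
  set η := H₂ * ((m₂ : ℝ) ^ (k₀ + 1))⁻¹ / m₁ with hη
  have hη0 : 0 < η := by positivity
  obtain ⟨_, ⟨⟨n₀, w₀⟩, rfl⟩, hw₀⟩ := exists_lt_of_lt_csSup
    (s := Set.range fun p : Σ n, Fin n → Fin m₁ => ν p.1 p.2)
    ⟨_, ⟨⟨0, Fin.elim0⟩, rfl⟩⟩ (show σ - η / m₁ < σ by linarith [div_pos hη0 hm₁0])
  -- The children average to `ν n w` and none exceeds `σ`, so each is within `η` of `ν n w`, hence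
  -- equal to it.
  have hchild : ∀ n w, σ - η / m₁ < ν n w → ∀ d : Fin m₁,
      ν (n + 1) (Fin.snoc w d : Fin (n + 1) → Fin m₁) = ν n w := by
    intro n w hw d
    set w' : Fin (n + 1) → Fin m₁ := Fin.snoc w d with hw'
    by_contra hne
    have h1 : |ν (n + 1) w' - ν n w| < η := by
      have h2 := hν_sum n w
      rw [← Finset.add_sum_erase _ _ (Finset.mem_univ d)] at h2
      have h3 : ∑ e ∈ Finset.univ.erase d, ν (n + 1) (Fin.snoc w e : Fin (n + 1) → Fin m₁) ≤
          (m₁ - 1) * σ := by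
        refine (Finset.sum_le_card_nsmul _ _ σ fun e _ => hνσ _ _).trans_eq ?_
        rw [Finset.card_erase_of_mem (Finset.mem_univ d), Finset.card_univ, Fintype.card_fin,
          nsmul_eq_mul, Nat.cast_sub (by omega), Nat.cast_one]
      have h4 : m₁ * (σ - ν n w) < η := by
        rw [← lt_div_iff₀' hm₁0]
        linarith
      have h5 := hνσ (n + 1) w'
      have h6 : η / m₁ ≤ η := div_le_self hη0.le (by exact_mod_cast (by omega : 1 ≤ m₁))
      have h7 := hνσ n w
      rw [abs_lt]
      constructor
      · linarith
      · linarith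
    have h8 : ν (n + 1) w' - ν n w = ((m₁ * M (n + 1) w' - M n w * m₂ ^ (k (n + 1) - k n) : ℤ) : ℝ)
        * (H₂ * ((m₁ : ℝ) ^ (n + 1) / (m₂ : ℝ) ^ k (n + 1)) / m₁) := by
      have h9 : (m₂ : ℝ) ^ k (n + 1) = (m₂ : ℝ) ^ k n * (m₂ : ℝ) ^ (k (n + 1) - k n) := by
        rw [← pow_add, Nat.add_sub_cancel' (hk_mono n.le_succ)]
      rw [hνM, hνM, h9]
      push_cast
      field_simp
      ring
    have h10 : (1 : ℝ) ≤
        |((m₁ * M (n + 1) w' - M n w * m₂ ^ (k (n + 1) - k n) : ℤ) : ℝ)| := by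
      rw [← Int.cast_abs]
      have : (m₁ * M (n + 1) w' - M n w * m₂ ^ (k (n + 1) - k n) : ℤ) ≠ 0 := fun h0 => by
        rw [h0, Int.cast_zero, zero_mul, sub_eq_zero] at h8
        exact hne h8
      exact_mod_cast Int.one_le_abs this
    rw [h8, abs_mul, abs_of_pos (by positivity : 0 < H₂ * ((m₁ : ℝ) ^ (n + 1) /
      (m₂ : ℝ) ^ k (n + 1)) / m₁)] at h1
    refine absurd h1 (not_lt.2 ?_)
    calc η ≤ H₂ * ((m₁ : ℝ) ^ (n + 1) / (m₂ : ℝ) ^ k (n + 1)) / m₁ := by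
          rw [hη]
          gcongr
          exact hscale _
      _ ≤ _ := le_mul_of_one_le_left (by positivity) h10
  have hchain : ∀ j, ∃ w, ν (n₀ + j) w = ν n₀ w₀ := by
    intro j
    induction j with
    | zero => exact ⟨w₀, rfl⟩
    | succ j ih =>
      obtain ⟨w, hw⟩ := ih
      exact ⟨_, (hchild (n₀ + j) w (hw₀.trans_eq hw.symm) ⟨0, by omega⟩).trans hw⟩
  choose w hw using hchain
  have hMbdd : ∀ j, M (n₀ + j) (w j) ≤ ⌊σ / (H₂ * ((m₂ : ℝ) ^ (k₀ + 1))⁻¹)⌋₊ := fun j => by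
    refine Nat.le_floor ?_
    rw [le_div_iff₀ (by positivity)]
    calc _ ≤ M (n₀ + j) (w j) * (H₂ * ((m₁ : ℝ) ^ (n₀ + j) / (m₂ : ℝ) ^ k (n₀ + j))) := by
          gcongr
          exact hscale _
      _ ≤ σ := by rw [← hνM]; exact hνσ _ _
  -- Equal densities and equal multipliers at two levels force equal scales `m₁ ^ n / m₂ ^ k n`.
  obtain ⟨i, j, hij, hMij⟩ := Finite.exists_ne_map_eq_of_infinite
    fun j => (⟨M (n₀ + j) (w j), Nat.lt_succ_of_le (hMbdd j)⟩ : Fin _)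
  wlog hlt : i < j generalizing i j
  · exact this j i hij.symm hMij.symm (by omega)
  have hMij' : M (n₀ + i) (w i) = M (n₀ + j) (w j) := congrArg Fin.val hMij
  have hkk : k (n₀ + i) ≤ k (n₀ + j) := hk_mono (by omega)
  have hpow : (m₁ : ℝ) ^ (j - i) = (m₂ : ℝ) ^ (k (n₀ + j) - k (n₀ + i)) := by
    have h1 := (hw i).trans (hw j).symm
    have h2 := hν_pos (n₀ + i) (w i)
    rw [hνM, hνM, ← hMij'] at h1
    rw [hνM] at h2
    have h3 := mul_left_cancel₀ (left_ne_zero_of_mul h2.ne') h1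
    have h4 := mul_left_cancel₀ hH₂0.ne' h3
    rw [div_eq_div_iff (by positivity) (by positivity)] at h4
    have h5 : (m₁ : ℝ) ^ (n₀ + j) = (m₁ : ℝ) ^ (n₀ + i) * (m₁ : ℝ) ^ (j - i) := by
      rw [← pow_add]
      congr 1
      omega
    have h6 : (m₂ : ℝ) ^ k (n₀ + j) =
        (m₂ : ℝ) ^ k (n₀ + i) * (m₂ : ℝ) ^ (k (n₀ + j) - k (n₀ + i)) := by
      rw [← pow_add, Nat.add_sub_cancel' hkk]
    rw [h5, h6] at h4
    have h7 : (m₁ : ℝ) ^ (n₀ + i) * (m₂ : ℝ) ^ k (n₀ + i) ≠ 0 := by positivity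
    refine mul_left_cancel₀ h7 ?_
    linarith
  have hpow' : m₁ ^ (j - i) = m₂ ^ (k (n₀ + j) - k (n₀ + i)) := by exact_mod_cast hpow
  refine ⟨j - i, k (n₀ + j) - k (n₀ + i), by omega, ?_, ?_, hpow'⟩
  · by_contra! h0
    rw [Nat.lt_one_iff.1 h0, pow_zero] at hpow'
    exact (Nat.one_lt_pow (by omega) (by omega)).ne' hpow'
  -- The ratios follow from the integers by taking `s`-th powers, as `r₁ ^ s` and `r₂ ^ s` are the
  -- inverses of `m₁` and `m₂`.
  · refine Real.rpow_left_injOn hs.ne' (pow_nonneg hr₁0.le _) (pow_nonneg hr₂0.le _) ?_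
    change (r₁ ^ (j - i)) ^ s = (r₂ ^ (k (n₀ + j) - k (n₀ + i))) ^ s
    rw [← Real.rpow_natCast, ← Real.rpow_natCast, ← Real.rpow_mul hr₁0.le, mul_comm,
      Real.rpow_mul hr₁0.le, hrs₁, ← Real.rpow_mul hr₂0.le, mul_comm, Real.rpow_mul hr₂0.le, hrs₂,
      Real.rpow_natCast, Real.rpow_natCast, inv_pow, inv_pow, hpow]

end SymbolicSpace

end Rigidity

/-! ### Transfer to the fractals and conclusion. -/

theorem two_le_of_mem_fractalClassOf {X : Type*} [MetricSpace X] {r : ℝ} {m : ℕ} {K : Set X}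
    (h : K ∈ FractalClassOf X r m) : 2 ≤ m := by
  obtain ⟨_, _, _, _, _, ⟨hm, _⟩, _⟩ := h
  exact hm

theorem dimH_univ_coe {X : Type*} [MetricSpace X] (K : Set X) :
    dimH (Set.univ : Set K) = dimH K := by
  rw [← (isometry_subtype_coe (s := K)).dimH_image, Set.image_univ, Subtype.range_coe]

theorem dimH_of_mem_fractalClassOf {X : Type*} [MetricSpace X] {r : ℝ}
    [hr : Fact (r ∈ Set.Ioo (0 : ℝ) 1)] {m : ℕ} {K : Set X} (h : K ∈ FractalClassOf X r m) :
    dimH K = ENNReal.ofReal (Real.log m / -Real.log r) := by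
  rw [← SymbolicSpace.dimH_univ (two_le_of_mem_fractalClassOf h),
    ← (bilipschitzEquivalent_symbolicSpace h).dimH_univ_eq, dimH_univ_coe]

theorem BilipschitzEquivalent.dimH_coe_eq {X Y : Type*} [MetricSpace X] [MetricSpace Y]
    {K : Set X} {K' : Set Y} (h : BilipschitzEquivalent K K') : dimH K = dimH K' := by
  have h1 := h.dimH_univ_eq
  rwa [dimH_univ_coe, dimH_univ_coe] at h1

theorem eq_of_mem_fractalClassOf_of_dimH_eq {X Y : Type*} [MetricSpace X] [MetricSpace Y] {r : ℝ}
    [hr : Fact (r ∈ Set.Ioo (0 : ℝ) 1)] {m m' : ℕ} {K : Set X} {K' : Set Y}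
    (h : K ∈ FractalClassOf X r m) (h' : K' ∈ FractalClassOf Y r m') (hd : dimH K = dimH K') :
    m = m' := by
  have hm := two_le_of_mem_fractalClassOf h
  have hm' := two_le_of_mem_fractalClassOf h'
  rw [dimH_of_mem_fractalClassOf h, dimH_of_mem_fractalClassOf h',
    ENNReal.ofReal_eq_ofReal_iff (SymbolicSpace.log_div_log_pos r hm).le
    (SymbolicSpace.log_div_log_pos r hm').le, div_left_inj'
    (neg_pos.2 (Real.log_neg hr.out.1 hr.out.2)).ne'] at hd
  exact_mod_cast Real.log_injOn_pos (Set.mem_Ioi.2 (by positivity)) (Set.mem_Ioi.2 (by positivity))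
    hd

theorem theorem2 {X : Type*} {Y : Type*} [MetricSpace X] [CompactSpace X]
    [MetricSpace Y] [CompactSpace Y] :
    (∀ r : ℝ, 0 < r → r < 1 →
      ∀ K ∈ FractalClass X r, ∀ K' ∈ FractalClass Y r,
        (BilipschitzEquivalent K K' ↔ dimH K = dimH K') ∧
        ∀ m m' : ℕ, K ∈ FractalClassOf X r m → K' ∈ FractalClassOf Y r m' →
          (BilipschitzEquivalent K K' ↔ m = m')) ∧
    (∀ r₁ r₂ : ℝ, 0 < r₁ → r₁ < 1 → 0 < r₂ → r₂ < 1 →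
      ∀ m₁ m₂ : ℕ, ∀ K ∈ FractalClassOf X r₁ m₁, ∀ K' ∈ FractalClassOf Y r₂ m₂,
        (BilipschitzEquivalent K K' ↔
          ∃ k₁ k₂ : ℕ, 1 ≤ k₁ ∧ 1 ≤ k₂ ∧ r₁ ^ k₁ = r₂ ^ k₂ ∧ m₁ ^ k₁ = m₂ ^ k₂)) := by
  constructor
  · intro r hr0 hr1 K hK K' hK'
    have : Fact (r ∈ Set.Ioo (0 : ℝ) 1) := ⟨hr0, hr1⟩
    have key : ∀ m m' : ℕ, K ∈ FractalClassOf X r m → K' ∈ FractalClassOf Y r m' → m = m' →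
        BilipschitzEquivalent K K' := by
      rintro m _ h h' rfl
      exact (bilipschitzEquivalent_symbolicSpace h).trans (bilipschitzEquivalent_symbolicSpace h').symm
    refine ⟨⟨fun h => h.dimH_coe_eq, fun hd => ?_⟩, fun m m' hm hm' =>
      ⟨fun h => eq_of_mem_fractalClassOf_of_dimH_eq hm hm' h.dimH_coe_eq, key m m' hm hm'⟩⟩
    obtain ⟨m, hm⟩ := Set.mem_iUnion.1 hK
    obtain ⟨m', hm'⟩ := Set.mem_iUnion.1 hK'
    exact key m m' hm hm' (eq_of_mem_fractalClassOf_of_dimH_eq hm hm' hd)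
  · intro r₁ r₂ hr₁ hr₁' hr₂ hr₂' m₁ m₂ K hK K' hK'
    have : Fact (r₁ ∈ Set.Ioo (0 : ℝ) 1) := ⟨hr₁, hr₁'⟩
    have : Fact (r₂ ∈ Set.Ioo (0 : ℝ) 1) := ⟨hr₂, hr₂'⟩
    have hm₁ := two_le_of_mem_fractalClassOf hK
    have hm₂ := two_le_of_mem_fractalClassOf hK'
    constructor
    · intro h
      exact SymbolicSpace.exists_pow_eq_of_bilipschitzEquivalent hm₁ hm₂
        (((bilipschitzEquivalent_symbolicSpace hK).symm.trans h).trans (bilipschitzEquivalent_symbolicSpace hK'))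
    · rintro ⟨k₁, k₂, hk₁, hk₂, hr, hm⟩
      have h1 : Fact (r₁ ^ k₁ ∈ Set.Ioo (0 : ℝ) 1) :=
        ⟨pow_pos hr₁ _, pow_lt_one₀ hr₁.le hr₁' (by omega)⟩
      -- Both shifts are regroupings of the one with `m₁ ^ k₁` letters and ratio `r₁ ^ k₁`.
      have e1 := SymbolicSpace.bilipschitzEquivalent_pow (r := r₁) (by omega : 0 < m₁) hk₁ rfl rfl
      have e2 := SymbolicSpace.bilipschitzEquivalent_pow (r := r₂) (by omega : 0 < m₂) hk₂ hm hr
      exact ((bilipschitzEquivalent_symbolicSpace hK).trans e1.symm).trans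
        (e2.trans (bilipschitzEquivalent_symbolicSpace hK').symm)
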